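/- Let $a\ge 2$ and let $A$ be an $a\times a$ matrix with entries in $\{0,1\}$ such that all entries of some power $A^d$ are positive. Let $\mathcal X=\{x\in\{1,\dots,a\}^{\mathbb Z}: A(x_n,x_{n+1})=1 \text{ for all } n\in\mathbb Z\}$ be the associated (topologically mixing, two-sided) subshift of finite type, with the shift $\sigma(x)_n=x_{n+1}$. Let $\mu$ be its Parry measure (measure of maximal entropy), i.e. the $\sigma$-invariant Borel probability measure with $-\lim_{n\to\infty}\frac1n\sum_{W}\mu(W)\log\mu(W)=\log\lambda$, where $W$ runs over the cylinders fixing the coordinates $0,\dots,n-1$ and $\lambda$ is the largest modulus of a complex eigenvalue of $A$. For each $n\ge 0$ let $\mathcal U_n\subset\mathcal X$ be a set with $\mu(\mathcal U_n)>0$ which is measurable with respect to the $\sigma$-algebra generated by the coordinates $-n,\dots,n-1$ (so $\mathcal U_0=\mathcal X$). Put $\tau_n(x)=\inf\{k\ge 1:\sigma^k(x)\in\mathcal U_n\}$ and $\eta_n=\inf\{\tau_n(x):x\in\mathcal U_n\}$. Suppose that at least one of the following three conditions holds. (i) $\sigma^{-(n+1)}\mathcal U_{n+1}\subset\sigma^{-n}\mathcal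 U_n$ for every $n>0$, and $n\,\mu(\mathcal U_{\lfloor\eta_n/2\rfloor})\to 0$ as $n\to\infty$. (ii) There is a non-decreasing function $k:\mathbb N\to\mathbb N$ with $\eta_n=n+k(n)+1$ for every $n\ge 1$ and $n\,\mu(\mathcal U_{k(n)})\to0$ as $n\to\infty$; moreover, either $\mathcal U_n\subset\mathcal U_{k(n)}$ for every $n\ge1$, or $\mathcal U_{n+1}\subset\mathcal U_n$ for every $n\ge 1$. (iii) There are sets $\mathcal V_n\supset\mathcal U_n$ $(n\ge1)$ with $n\,\mu(\mathcal V_n)\to0$ as $n\to\infty$ such that, for every $n\ge1$, $\mathcal V_n$ is measurable with respect to the $\sigma$-algebra generated by the coordinates $-n,\dots,-n+\lfloor\eta_n/2\rfloor$ or with respect to the one generated by the coordinates $n-\lfloor\eta_n/2\rfloor,\dots,n-1$. Then $X_n=\mu(\mathcal U_n)\,\tau_n$ converges in law to an exponential random variable of parameter $1$: for every $t\in\mathbb R$, $\mu\{x\in\mathcal X: X_n(x)\le t\}$ converges, as $n\to\infty$, to $1-e^{-t}$ if $t\ge0$ and to $0$ if $t<0$. -/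

import Mathlib

open MeasureTheory Filter Topology
open scoped ENNReal

/-- `A` is a transition matrix: it has entries `0` and `1`, and it is irreducible and aperiodic,
that is, some power of `A` has only positive entries. -/
structure IsTransitionMatrix {a : ℕ} (A : Matrix (Fin a) (Fin a) ℕ) : Prop where
  zero_or_one : ∀ i j, A i j = 0 ∨ A i j = 1
  exists_pow_pos : ∃ d : ℕ, ∀ i j, 0 < (A ^ d) i j

/-- The two-sided subshift of finite type with matrix `A`; its measurable structure is the one
induced by the product σ-algebra of the discrete alphabet. -/
abbrev SFT {a : ℕ} (A : Matrix (Fin a) (Fin a) ℕ) : Type :=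
  {x : ℤ → Fin a // ∀ n : ℤ, A (x n) (x (n + 1)) = 1}

namespace SFT

variable {a : ℕ} {A : Matrix (Fin a) (Fin a) ℕ}

/-- The left shift `(σ x) n = x (n + 1)`. -/
def shift (x : SFT A) : SFT A :=
  ⟨fun n => x.1 (n + 1), fun n => x.2 (n + 1)⟩

/-- The σ-algebra on the subshift generated by the coordinates in `I`. -/
@[reducible]
def coordAlgebra (A : Matrix (Fin a) (Fin a) ℕ) (I : Set ℤ) : MeasurableSpace (SFT A) :=
  MeasurableSpace.comap (fun (x : SFT A) (i : I) => x.1 i) inferInstance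

/-- The cylinder of all `x` with `x 0 … x (n - 1)` equal to the word `w` (possibly empty). -/
def cylinder (A : Matrix (Fin a) (Fin a) ℕ) {n : ℕ} (w : Fin n → Fin a) : Set (SFT A) :=
  {x | ∀ i : Fin n, x.1 (i : ℕ) = w i}

/-- The largest modulus of a complex eigenvalue of `A`. -/
noncomputable def firstEigenvalue (A : Matrix (Fin a) (Fin a) ℕ) : ℝ :=
  sSup {r : ℝ | ∃ (γ : ℂ) (v : Fin a → ℂ),
    v ≠ 0 ∧ (A.map (Nat.cast : ℕ → ℂ)).mulVec v = γ • v ∧ r = ‖γ‖}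

/-- The topological entropy of the subshift. -/
noncomputable def topEntropy (A : Matrix (Fin a) (Fin a) ℕ) : ℝ :=
  Real.log (firstEigenvalue A)

/-- The Shannon entropy of `μ` with respect to the partition into cylinders of length `n`, that is,
`-∑ μ(W) log μ(W)` (words which do not occur contribute `0`). -/
noncomputable def cylinderEntropy (μ : Measure (SFT A)) (n : ℕ) : ℝ :=
  ∑ w : Fin n → Fin a, Real.negMulLog (μ.real (cylinder A w))

/-- `μ` is the Parry measure (measure of maximal entropy): the shift-invariant probability measure
whose entropy equals the topological entropy. -/
structure IsParryMeasure (μ : Measure (SFT A)) : Prop where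
  isProbabilityMeasure : IsProbabilityMeasure μ
  measurePreserving : MeasurePreserving shift μ μ
  entropy_eq :
    Tendsto (fun n : ℕ => (1 / (n : ℝ)) * cylinderEntropy μ n) atTop (𝓝 (topEntropy A))

/-- The entry time `inf {k ≥ 1 | σ^k x ∈ U}`, equal to `⊤` if the orbit never enters `U`. -/
noncomputable def entryTime (U : Set (SFT A)) (x : SFT A) : ℕ∞ :=
  sInf {m : ℕ∞ | ∃ k : ℕ, 1 ≤ k ∧ shift^[k] x ∈ U ∧ m = (k : ℕ∞)}

/-- The return time `inf {τ_U(x) | x ∈ U}`. -/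
noncomputable def returnTime (U : Set (SFT A)) : ℕ∞ :=
  sInf (entryTime U '' U)

/-- `⌊η / 2⌋` for the return time `η` of `U` (which is finite if `U` has positive measure for some
invariant probability measure). -/
noncomputable def halfReturn (U : Set (SFT A)) : ℕ :=
  (returnTime U).toNat / 2

/-- The rescaled entry time `μ(U) τ_U`. -/
noncomputable def rescaledEntryTime (μ : Measure (SFT A)) (U : Set (SFT A)) (x : SFT A) : ℝ≥0∞ :=
  μ U * (entryTime U x : ℝ≥0∞)

end SFT

/-- Convergence in law of `[0, ∞]`-valued random variables to an exponential random variable of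
parameter `1`: the distribution functions `t ↦ P(X_n ≤ t)` converge, at every real `t`, to the
distribution function of `Exp(1)`. -/
def ConvergesInLawToExpOne {Ω : Type*} [MeasurableSpace Ω] (P : Measure Ω)
    (X : ℕ → Ω → ℝ≥0∞) : Prop :=
  ∀ t : ℝ, Tendsto (fun n => P {ω | ((X n ω : ℝ≥0∞) : EReal) ≤ (t : EReal)}) atTop
    (𝓝 (ENNReal.ofReal (if 0 ≤ t then 1 - Real.exp (-t) else 0)))

/-!
The proof has two independent halves.

*The Parry measure is ψ-mixing.* Let `r` be a right Perron eigenvector of `A` and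
`Q i j = A i j r j / (λ r i)`. Gibbs' inequality against `Q` and stationarity show that each
conditional entropy `H (n + 1) - H n`, `n ≥ 1`, is at most `log λ`. These increments decrease and
their averages tend to `log λ`, so all of them equal `log λ`, and the equality case says that `μ` is
the Markov measure with transition matrix `Q` (`SFT.IsParryMeasure.isMarkov`). As `Q` is primitive,
Doeblin's argument gives `Q ^ n → p` (`stochastic_pow_tendsto`), and the Markov property turns this
into near independence of events separated by a gap, with relative error
(`SFT.IsParryMeasure.isPsiMixing`).

*Rare short returns give the exponential law.* Write `u = μ(U)` and `F k = μ(τ > k)`. Stationarity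
gives `F (k + 1) = F k - μ(U ∩ {τ > k})`, so if `|μ(U ∩ {τ > k}) - u F k| ≤ δ u` for all `k`, then
`|F k - (1 - u) ^ k| ≤ δ` for all `k` (`abs_sub_geometric_le`), and `(1 - u) ^ ⌊t / u⌋ → exp (-t)`.
Such a `δ` is obtained by discarding the entries at the times below `2 n + g` and then using mixing
with gap `g`; the discarded part is small if `μ(U n ∩ σ^{-j} U n) ≤ K e n μ(U n)` for all `j ≥ 1`
and `μ(U n) ≤ e n` with `n e n → 0` (`SFT.convergesInLaw_of_rare_returns`).

Each of the three conditions provides such `e n`. Only `j ≥ η n` matter, and for these the set `U n`,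
on one of the two sides, can be enlarged to a set whose coordinates are disjoint from those on the
other side; `e n` is the measure of the enlarged set. In the first condition and in the nested
variant of the second, the enlarged set is taken with index `min (⌊η n / 2⌋) n` or `min (k n) n`:
the indices `⌊η n / 2⌋` and `k n` may exceed `n`, but by mixing only by a bounded amount, so
that the rate `o(1 / n)` is not lost (`tendsto_mul_min`).
-/

/-! ### The Perron eigenvector of a primitive matrix -/

section Perron

variable {ι : Type*} [Fintype ι]

lemma Matrix.mulVec_nonneg_of_nonneg {M : Matrix ι ι ℝ} (hM : ∀ i j, 0 ≤ M i j) {x : ι → ℝ}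
    (hx : 0 ≤ x) : 0 ≤ M.mulVec x :=
  fun i => Finset.sum_nonneg fun j _ => mul_nonneg (hM i j) (hx j)

lemma Matrix.mulVec_pos_of_pos {M : Matrix ι ι ℝ} (hM : ∀ i j, 0 < M i j) {x : ι → ℝ}
    (hx : 0 ≤ x) (hx0 : x ≠ 0) (i : ι) : 0 < M.mulVec x i := by
  obtain ⟨j, hj⟩ := Function.ne_iff.1 hx0
  exact Finset.sum_pos' (fun k _ => mul_nonneg (hM i k).le (hx k))
    ⟨j, Finset.mem_univ j, mul_pos (hM i j) (lt_of_le_of_ne (hx j) (Ne.symm hj))⟩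

/-- The largest `t` for which `t • x ≤ M x` has a solution in the standard simplex exists; this is
the Collatz–Wielandt description of the Perron eigenvalue. -/
lemma exists_max_subinvariant [Nonempty ι] {M : Matrix ι ι ℝ} (hM : ∀ i j, 0 ≤ M i j) :
    ∃ (l : ℝ) (x : ι → ℝ), 0 ≤ l ∧ 0 ≤ x ∧ x ≠ 0 ∧ l • x ≤ M.mulVec x ∧
      ∀ (t : ℝ) (y : ι → ℝ), 0 ≤ y → y ≠ 0 → t • y ≤ M.mulVec y → t ≤ l := by
  classical
  set B : ℝ := ∑ i, ∑ j, M i j with hB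
  have hB0 : 0 ≤ B := Finset.sum_nonneg fun i _ => Finset.sum_nonneg fun j _ => hM i j
  set S : Set ((ι → ℝ) × ℝ) := (stdSimplex ℝ ι ×ˢ Set.Icc 0 B) ∩
    {q | q.2 • q.1 ≤ M.mulVec q.1} with hS
  have hcont : Continuous fun q : (ι → ℝ) × ℝ => M.mulVec q.1 :=
    Continuous.matrix_mulVec continuous_const continuous_fst
  have hScomp : IsCompact S :=
    ((isCompact_stdSimplex ℝ ι).prod isCompact_Icc).inter_right
      (isClosed_le (continuous_snd.smul continuous_fst) hcont)
  have hle : ∀ (t : ℝ) (y : ι → ℝ), y ∈ stdSimplex ℝ ι → t • y ≤ M.mulVec y → t ≤ B := by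
    intro t y hy hty
    have h1 : ∀ j, y j ≤ 1 := fun j => by
      rw [← hy.2]
      exact Finset.single_le_sum (fun k _ => hy.1 k) (Finset.mem_univ j)
    calc t = ∑ i, t * y i := by rw [← Finset.mul_sum, hy.2, mul_one]
      _ ≤ ∑ i, M.mulVec y i := Finset.sum_le_sum fun i _ => hty i
      _ ≤ B := Finset.sum_le_sum fun i _ => Finset.sum_le_sum fun j _ =>
          mul_le_of_le_one_right (hM i j) (h1 j)
  have hSne : S.Nonempty := by
    obtain ⟨i⟩ := ‹Nonempty ι›
    refine ⟨(Pi.single i 1, 0), ⟨single_mem_stdSimplex ℝ i, le_rfl, hB0⟩, ?_⟩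
    have h0 := Matrix.mulVec_nonneg_of_nonneg hM (single_mem_stdSimplex ℝ i).1
    simpa using h0
  obtain ⟨⟨x, l⟩, ⟨⟨hx, hl⟩, hxl⟩, hmax⟩ := hScomp.exists_isMaxOn hSne continuous_snd.continuousOn
  have hx0 : x ≠ 0 := by
    rintro rfl
    simpa using hx.2
  refine ⟨l, x, hl.1, hx.1, hx0, hxl, fun t y hy hy0 hty => ?_⟩
  rcases lt_or_ge t 0 with ht | ht
  · exact ht.le.trans hl.1
  have hs : 0 < ∑ i, y i := by
    obtain ⟨j, hj⟩ := Function.ne_iff.1 hy0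
    exact Finset.sum_pos' (fun k _ => hy k)
      ⟨j, Finset.mem_univ j, lt_of_le_of_ne (hy j) (Ne.symm hj)⟩
  set s := ∑ i, y i
  have hmem : s⁻¹ • y ∈ stdSimplex ℝ ι := by
    refine ⟨fun i => mul_nonneg (inv_nonneg.2 hs.le) (hy i), ?_⟩
    simp only [Pi.smul_apply, smul_eq_mul, ← Finset.mul_sum]
    exact inv_mul_cancel₀ hs.ne'
  have hty' : t • (s⁻¹ • y) ≤ M.mulVec (s⁻¹ • y) := by
    rw [Matrix.mulVec_smul, smul_comm]
    exact smul_le_smul_of_nonneg_left hty (inv_nonneg.2 hs.le)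
  exact hmax (a := (s⁻¹ • y, t)) ⟨⟨hmem, ht, hle t _ hmem hty'⟩, hty'⟩

/-- **Perron's theorem**: a nonnegative matrix with a positive power has a positive eigenvector,
whose eigenvalue dominates every subinvariance constant. -/
lemma exists_perron_eigenvector [Nonempty ι] [DecidableEq ι] {M : Matrix ι ι ℝ}
    (hM : ∀ i j, 0 ≤ M i j) {d : ℕ} (hd0 : d ≠ 0) (hd : ∀ i j, 0 < (M ^ d) i j) :
    ∃ (l : ℝ) (x : ι → ℝ), 0 < l ∧ (∀ i, 0 < x i) ∧ M.mulVec x = l • x ∧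
      ∀ (t : ℝ) (y : ι → ℝ), 0 ≤ y → y ≠ 0 → t • y ≤ M.mulVec y → t ≤ l := by
  obtain ⟨l, x, hl, hx, hx0, hxl, hmax⟩ := exists_max_subinvariant hM
  have hcomm : ∀ y, (M ^ d).mulVec (M.mulVec y) = M.mulVec ((M ^ d).mulVec y) := fun y => by
    rw [Matrix.mulVec_mulVec, Matrix.mulVec_mulVec, ← pow_succ, ← pow_succ']
  have heq : M.mulVec x = l • x := by
    by_contra hne
    -- otherwise `y = M ^ d x` satisfies `l y < M y` strictly, so that `l` could be increased
    set y := (M ^ d).mulVec x with hy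
    have hypos : ∀ i, 0 < y i := Matrix.mulVec_pos_of_pos hd hx hx0
    have hstrict : ∀ i, l * y i < M.mulVec y i := fun i => by
      have h := Matrix.mulVec_pos_of_pos hd (sub_nonneg.2 hxl) (sub_ne_zero.2 hne) i
      rw [Matrix.mulVec_sub, hcomm, Matrix.mulVec_smul] at h
      exact sub_pos.1 h
    have hev : ∀ᶠ t in 𝓝[>] l, ∀ i, t * y i ≤ M.mulVec y i := by
      refine eventually_all.2 fun i => nhdsWithin_le_nhds ?_
      have hc : Tendsto (fun t : ℝ => t * y i) (𝓝 l) (𝓝 (l * y i)) :=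
        (continuous_id.mul continuous_const).tendsto l
      exact (hc.eventually_lt_const (hstrict i)).mono fun t ht => ht.le
    obtain ⟨t, ht, hlt⟩ := (hev.and self_mem_nhdsWithin).exists
    obtain ⟨i⟩ := ‹Nonempty ι›
    have hy0 : y ≠ 0 := fun h => (hypos i).ne' (congrFun h i)
    exact absurd (hmax t y (fun i => (hypos i).le) hy0 ht) (not_le.2 hlt)
  have hpow : ∀ n : ℕ, (M ^ n).mulVec x = l ^ n • x := by
    intro n
    induction n with
    | zero => simp
    | succ n ih =>
      rw [pow_succ, ← Matrix.mulVec_mulVec, heq, Matrix.mulVec_smul, ih, smul_smul, pow_succ']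
  have hxpos : ∀ i, 0 < x i := fun i => by
    have h := Matrix.mulVec_pos_of_pos hd hx hx0 i
    rw [hpow d] at h
    exact pos_of_mul_pos_right h (pow_nonneg hl d)
  refine ⟨l, x, lt_of_le_of_ne hl ?_, hxpos, heq, hmax⟩
  rintro rfl
  obtain ⟨i⟩ := ‹Nonempty ι›
  have h := Matrix.mulVec_pos_of_pos hd hx hx0 i
  rw [hpow d] at h
  simp [hd0] at h

end Perron

namespace SFT

variable {a : ℕ} {A : Matrix (Fin a) (Fin a) ℕ}

/-- A right Perron eigenvector of the transition matrix, for the eigenvalue `firstEigenvalue A`. -/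
lemma exists_perron (ha : 2 ≤ a) (hA : IsTransitionMatrix A) :
    0 < firstEigenvalue A ∧ ∃ r : Fin a → ℝ, (∀ i, 0 < r i) ∧
      ∀ i, ∑ j, (A i j : ℝ) * r j = firstEigenvalue A * r i := by
  have : Nonempty (Fin a) := ⟨⟨0, by omega⟩⟩
  set M : Matrix (Fin a) (Fin a) ℝ := A.map (Nat.castRingHom ℝ) with hMdef
  have hM : ∀ i j, 0 ≤ M i j := fun i j => Nat.cast_nonneg _
  obtain ⟨d, hd⟩ := hA.exists_pow_pos
  have hd' : ∀ i j, 0 < (M ^ d) i j := fun i j => by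
    rw [hMdef, ← Matrix.map_pow]
    exact Nat.cast_pos.2 (hd i j)
  have hd0 : d ≠ 0 := by
    rintro rfl
    have h := hd ⟨0, by omega⟩ ⟨1, by omega⟩
    simp at h
  obtain ⟨l, r, hl, hr, hlr, hmax⟩ := exists_perron_eigenvector hM hd0 hd'
  have hfirst : firstEigenvalue A = l := by
    refine IsGreatest.csSup_eq ⟨⟨(l : ℂ), fun i => (r i : ℂ), ?_, ?_, ?_⟩, ?_⟩
    · intro h
      have := congrFun h ⟨0, by omega⟩
      simp only [Pi.zero_apply, Complex.ofReal_eq_zero] at this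
      exact (hr _).ne' this
    · ext i
      have h := congrFun hlr i
      simp only [Matrix.mulVec, dotProduct, hMdef, Matrix.map_apply, Pi.smul_apply,
        smul_eq_mul, Nat.coe_castRingHom] at h ⊢
      exact_mod_cast h
    · simp [abs_of_pos hl]
    · rintro _ ⟨γ, v, hv, hAv, rfl⟩
      refine hmax ‖γ‖ (fun i => ‖v i‖) (fun i => norm_nonneg _) ?_ fun i => ?_
      · intro h
        exact hv (funext fun i => norm_eq_zero.1 (congrFun h i))
      · have h := congrFun hAv i
        simp only [Matrix.mulVec, dotProduct, Matrix.map_apply, Pi.smul_apply, smul_eq_mul] at h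
        simp only [Matrix.mulVec, dotProduct, hMdef, Matrix.map_apply, Pi.smul_apply, smul_eq_mul,
          Nat.coe_castRingHom]
        rw [← norm_mul, ← h]
        refine (norm_sum_le _ _).trans (Finset.sum_le_sum fun j _ => ?_)
        rw [norm_mul, Complex.norm_natCast]
  refine ⟨hfirst ▸ hl, r, hr, fun i => ?_⟩
  have h := congrFun hlr i
  rw [hfirst]
  simpa [Matrix.mulVec, dotProduct, hMdef] using h

end SFT

/-! ### Measures of maximal entropy are Markov -/

/-- The pointwise Gibbs inequality. -/
lemma sub_le_mul_log_sub_log {x y : ℝ} (hx : 0 ≤ x) (hy : 0 ≤ y) (h : y = 0 → x = 0) :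
    x - y ≤ x * (Real.log x - Real.log y) := by
  rcases hx.eq_or_lt with rfl | hx
  · simpa using hy
  have hy : 0 < y := hy.lt_of_ne fun h0 => hx.ne' (h h0.symm)
  have h1 := Real.log_le_sub_one_of_pos (div_pos hy hx)
  rw [Real.log_div hy.ne' hx.ne'] at h1
  have h2 := mul_le_mul_of_nonneg_left h1 hx.le
  have h3 : x * (y / x - 1) = y - x := by field_simp
  linarith

lemma eq_of_mul_log_sub_log_eq {x y : ℝ} (hx : 0 ≤ x) (hy : 0 ≤ y) (h : y = 0 → x = 0)
    (heq : x * (Real.log x - Real.log y) = x - y) : x = y := by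
  rcases hx.eq_or_lt with rfl | hx
  · linarith
  have hy : 0 < y := hy.lt_of_ne fun h0 => hx.ne' (h h0.symm)
  by_contra hne
  have h1 := Real.log_lt_sub_one_of_pos (div_pos hy hx)
    (fun h1 => hne ((div_eq_one_iff_eq hx.ne').1 h1).symm)
  rw [Real.log_div hy.ne' hx.ne'] at h1
  have h2 := mul_lt_mul_of_pos_left h1 hx
  have h3 : x * (y / x - 1) = y - x := by field_simp
  linarith

lemma Fin.sum_eq_sum_sum_snoc {α M : Type*} [Fintype α] [AddCommMonoid M] {n : ℕ}
    (f : (Fin (n + 1) → α) → M) :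
    ∑ w, f w = ∑ w : Fin n → α, ∑ j, f (Fin.snoc (α := fun _ => α) w j) := by
  rw [← (Fin.snocEquiv fun _ : Fin (n + 1) => α).sum_comp, Fintype.sum_prod_type, Finset.sum_comm]
  rfl

lemma Fin.sum_eq_sum_sum_cons {α M : Type*} [Fintype α] [AddCommMonoid M] {n : ℕ}
    (f : (Fin (n + 1) → α) → M) :
    ∑ w, f w = ∑ w : Fin n → α, ∑ i, f (Fin.cons (α := fun _ => α) i w) := by
  rw [← (Fin.consEquiv fun _ : Fin (n + 1) => α).sum_comp, Fintype.sum_prod_type, Finset.sum_comm]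
  rfl

/-- If the increments of `H` decrease and are bounded by `l`, and `H n / n → l`, then all the
increments equal `l`. -/
lemma increment_eq_of_tendsto {H : ℕ → ℝ} {l : ℝ}
    (hanti : ∀ n, H (n + 2) - H (n + 1) ≤ H (n + 1) - H n)
    (hlim : Tendsto (fun n : ℕ => 1 / (n : ℝ) * H n) atTop (𝓝 l)) {m : ℕ}
    (hle : H (m + 1) - H m ≤ l) : H (m + 1) - H m = l := by
  refine le_antisymm hle ?_
  set D := H (m + 1) - H m with hD
  have hstep : ∀ k, H (m + k + 1) - H (m + k) ≤ D := by
    intro k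
    induction k with
    | zero => exact le_rfl
    | succ k ih => exact (hanti (m + k)).trans ih
  have hlin : ∀ k : ℕ, H (m + k) ≤ H m + k * D := by
    intro k
    induction k with
    | zero => simp
    | succ k ih =>
      have h := hstep k
      push_cast
      rw [← add_assoc]
      linarith
  have hlim2 : Tendsto (fun n : ℕ => 1 / (n : ℝ) * (H m - m * D) + D) atTop (𝓝 D) := by
    simpa using (tendsto_one_div_atTop_nhds_zero_nat.mul_const (H m - m * D)).add_const D
  refine le_of_tendsto_of_tendsto hlim hlim2 ?_
  filter_upwards [eventually_ge_atTop m, eventually_gt_atTop 0] with n hn hn0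
  obtain ⟨k, rfl⟩ := Nat.exists_eq_add_of_le hn
  have hp : (0 : ℝ) < ((m + k : ℕ) : ℝ) := Nat.cast_pos.2 hn0
  have h := mul_le_mul_of_nonneg_left (hlin k) (one_div_pos.2 hp).le
  refine h.trans (le_of_eq ?_)
  field_simp
  push_cast
  ring

namespace SFT

variable {a : ℕ} {A : Matrix (Fin a) (Fin a) ℕ} {μ : Measure (SFT A)}

lemma measurable_coord (n : ℤ) : Measurable fun x : SFT A => x.1 n :=
  (measurable_pi_apply n).comp measurable_subtype_coe

lemma measurable_shift : Measurable (shift : SFT A → SFT A) :=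
  (measurable_pi_lambda _ fun n => measurable_coord (n + 1)).subtype_mk

@[simp]
lemma shift_iterate_apply (k : ℕ) (x : SFT A) (n : ℤ) : (shift^[k] x).1 n = x.1 (n + k) := by
  induction k generalizing x with
  | zero => simp
  | succ k ih =>
    rw [Function.iterate_succ_apply, ih]
    simp only [shift]
    push_cast
    ring_nf

lemma measurableSet_coord_eq (n : ℤ) (i : Fin a) : MeasurableSet {x : SFT A | x.1 n = i} :=
  measurable_coord n (measurableSet_singleton i)

lemma measurableSet_cylinder {n : ℕ} (w : Fin n → Fin a) : MeasurableSet (cylinder A w) := by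
  have : cylinder A w = ⋂ i : Fin n, {x : SFT A | x.1 (i : ℕ) = w i} := by
    ext x; simp [cylinder]
  rw [this]
  exact MeasurableSet.iInter fun i => measurableSet_coord_eq _ _

lemma cylinder_snoc {n : ℕ} (w : Fin n → Fin a) (j : Fin a) :
    cylinder A (Fin.snoc (α := fun _ => Fin a) w j) = cylinder A w ∩ {x | x.1 (n : ℤ) = j} := by
  ext x
  simp [cylinder, Fin.forall_fin_succ']

lemma cylinder_cons {n : ℕ} (i : Fin a) (w : Fin n → Fin a) :
    cylinder A (Fin.cons (α := fun _ => Fin a) i w) =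
      shift ⁻¹' cylinder A w ∩ {x | x.1 0 = i} := by
  ext x
  simp [cylinder, Fin.forall_fin_succ, shift, and_comm]

/-- Decomposition of the measure of a set along a finite-valued measurable function. -/
lemma sum_real_inter_eq {Ω β : Type*} [MeasurableSpace Ω] {ν : Measure Ω} [IsFiniteMeasure ν]
    [Fintype β] {f : Ω → β} (hf : ∀ b, MeasurableSet {x | f x = b}) {E : Set Ω}
    (hE : MeasurableSet E) : ∑ b, ν.real (E ∩ {x | f x = b}) = ν.real E := by
  rw [← measureReal_iUnion_fintype ?_ fun b => hE.inter (hf b)]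
  · congr 1
    ext x
    simp
  · intro b c hbc
    refine Set.disjoint_left.2 fun x hx hx' => hbc ?_
    exact hx.2.symm.trans hx'.2

lemma sum_real_cylinder_snoc [IsFiniteMeasure μ] {n : ℕ} (w : Fin n → Fin a) :
    ∑ j, μ.real (cylinder A (Fin.snoc (α := fun _ => Fin a) w j)) = μ.real (cylinder A w) := by
  simp only [cylinder_snoc]
  exact sum_real_inter_eq (fun j => measurableSet_coord_eq _ _) (measurableSet_cylinder w)

lemma sum_real_cylinder_cons [IsFiniteMeasure μ] (hσ : MeasurePreserving shift μ μ) {n : ℕ}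
    (w : Fin n → Fin a) :
    ∑ i, μ.real (cylinder A (Fin.cons (α := fun _ => Fin a) i w)) = μ.real (cylinder A w) := by
  simp only [cylinder_cons]
  rw [sum_real_inter_eq (fun j => measurableSet_coord_eq _ _)
    (measurable_shift (measurableSet_cylinder w)),
    hσ.measureReal_preimage (measurableSet_cylinder w).nullMeasurableSet]

lemma sum_real_cylinder [IsProbabilityMeasure μ] (n : ℕ) :
    ∑ w : Fin n → Fin a, μ.real (cylinder A w) = 1 := by
  induction n with
  | zero =>
    have h : ∀ w : Fin 0 → Fin a, cylinder A w = Set.univ := fun w => by ext; simp [cylinder]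
    simp [h]
  | succ n ih =>
    rw [Fin.sum_eq_sum_sum_snoc]
    simpa only [sum_real_cylinder_snoc] using ih

lemma real_cylinder_snoc_le [IsFiniteMeasure μ] {n : ℕ} (w : Fin n → Fin a) (j : Fin a) :
    μ.real (cylinder A (Fin.snoc (α := fun _ => Fin a) w j)) ≤ μ.real (cylinder A w) := by
  rw [cylinder_snoc]
  exact measureReal_mono Set.inter_subset_left

lemma real_cylinder_cons_le [IsFiniteMeasure μ] (hσ : MeasurePreserving shift μ μ) {n : ℕ}
    (i : Fin a) (w : Fin n → Fin a) :
    μ.real (cylinder A (Fin.cons (α := fun _ => Fin a) i w)) ≤ μ.real (cylinder A w) := by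
  rw [cylinder_cons, ← hσ.measureReal_preimage (measurableSet_cylinder w).nullMeasurableSet]
  exact measureReal_mono Set.inter_subset_left

lemma sum_mul_log_cylinder (n : ℕ) :
    ∑ w : Fin n → Fin a, μ.real (cylinder A w) * Real.log (μ.real (cylinder A w)) =
      -cylinderEntropy μ n := by
  simp [cylinderEntropy, Real.negMulLog]

/-- The conditional entropies of a stationary measure decrease. -/
lemma cylinderEntropy_increment_antitone [IsProbabilityMeasure μ]
    (hσ : MeasurePreserving shift μ μ) (n : ℕ) :
    cylinderEntropy μ (n + 2) - cylinderEntropy μ (n + 1) ≤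
      cylinderEntropy μ (n + 1) - cylinderEntropy μ n := by
  -- Gibbs' inequality against the weights `P (i w) P (w j) / P w`
  let P : ∀ {m : ℕ}, (Fin m → Fin a) → ℝ := fun w => μ.real (cylinder A w)
  let c : ∀ {m : ℕ}, Fin a → (Fin m → Fin a) → (Fin (m + 1) → Fin a) :=
    fun i w => Fin.cons (α := fun _ => Fin a) i w
  let s : ∀ {m : ℕ}, (Fin m → Fin a) → Fin a → (Fin (m + 1) → Fin a) :=
    fun w j => Fin.snoc (α := fun _ => Fin a) w j
  have hcs : ∀ i (w : Fin n → Fin a) j, c i (s w j) = s (c i w) j := fun i w j =>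
    Fin.cons_snoc_eq_snoc_cons (β := Fin a) i w j
  have hs : ∀ {m : ℕ} (w : Fin m → Fin a), ∑ j, P (s w j) = P w := fun w =>
    sum_real_cylinder_snoc w
  have hc : ∀ {m : ℕ} (w : Fin m → Fin a), ∑ i, P (c i w) = P w := fun w =>
    sum_real_cylinder_cons hσ w
  have h0 : ∀ {m : ℕ} (w : Fin m → Fin a), 0 ≤ P w := fun w => measureReal_nonneg
  have hterm : ∀ (w : Fin n → Fin a) (i j : Fin a),
      P (c i (s w j)) - P (c i w) * P (s w j) / P w ≤
        P (c i (s w j)) * Real.log (P (c i (s w j))) - P (c i (s w j)) * Real.log (P (c i w))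
          - P (c i (s w j)) * Real.log (P (s w j)) + P (c i (s w j)) * Real.log (P w) := by
    intro w i j
    rcases (h0 (c i (s w j))).eq_or_lt with hx | hx
    · rw [← hx]
      have : 0 ≤ P (c i w) * P (s w j) / P w := div_nonneg (mul_nonneg (h0 _) (h0 _)) (h0 _)
      simpa using this
    have h1 : 0 < P (s w j) := hx.trans_le (real_cylinder_cons_le hσ _ _)
    have h2 : 0 < P (c i w) := by
      rw [hcs] at hx
      exact hx.trans_le (real_cylinder_snoc_le _ _)
    have h3 : 0 < P w := h2.trans_le (real_cylinder_cons_le hσ _ _)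
    have h4 := sub_le_mul_log_sub_log hx.le (y := P (c i w) * P (s w j) / P w) (by positivity)
      (fun h => absurd h (by positivity))
    rw [Real.log_div (by positivity) h3.ne', Real.log_mul h2.ne' h1.ne'] at h4
    linarith
  have hsum := Finset.sum_le_sum fun (w : Fin n → Fin a) (_ : w ∈ Finset.univ) =>
    Finset.sum_le_sum fun (i : Fin a) (_ : i ∈ Finset.univ) =>
      Finset.sum_le_sum fun (j : Fin a) (_ : j ∈ Finset.univ) => hterm w i j
  simp only [Finset.sum_add_distrib, Finset.sum_sub_distrib] at hsum
  have e0 : ∑ w : Fin n → Fin a, ∑ i, ∑ j, P (c i (s w j)) = 1 := by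
    rw [← sum_real_cylinder (μ := μ) n]
    refine Finset.sum_congr rfl fun w _ => ?_
    simp only [hcs, hs, hc]
    rfl
  have e0' : ∑ w : Fin n → Fin a, ∑ i, ∑ j, P (c i w) * P (s w j) / P w = 1 := by
    rw [← sum_real_cylinder (μ := μ) n]
    refine Finset.sum_congr rfl fun w _ => ?_
    simp only [← Finset.sum_div, ← Finset.mul_sum, hs, ← Finset.sum_mul, hc]
    exact mul_self_div_self _
  have e1 : ∑ w : Fin n → Fin a, ∑ i, ∑ j, P (c i (s w j)) * Real.log (P (c i (s w j))) =
      -cylinderEntropy μ (n + 2) := by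
    rw [← sum_mul_log_cylinder, Fin.sum_eq_sum_sum_cons, Fin.sum_eq_sum_sum_snoc]
    exact Finset.sum_congr rfl fun w _ => Finset.sum_comm
  have e2 : ∑ w : Fin n → Fin a, ∑ i, ∑ j, P (c i (s w j)) * Real.log (P (c i w)) =
      -cylinderEntropy μ (n + 1) := by
    rw [← sum_mul_log_cylinder, Fin.sum_eq_sum_sum_cons]
    simp only [hcs, ← Finset.sum_mul, hs]
    rfl
  have e3 : ∑ w : Fin n → Fin a, ∑ i, ∑ j, P (c i (s w j)) * Real.log (P (s w j)) =
      -cylinderEntropy μ (n + 1) := by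
    rw [← sum_mul_log_cylinder, Fin.sum_eq_sum_sum_snoc]
    refine Finset.sum_congr rfl fun w _ => ?_
    rw [Finset.sum_comm]
    simp only [← Finset.sum_mul, hc]
    rfl
  have e4 : ∑ w : Fin n → Fin a, ∑ i, ∑ j, P (c i (s w j)) * Real.log (P w) =
      -cylinderEntropy μ n := by
    rw [← sum_mul_log_cylinder]
    simp only [hcs, ← Finset.sum_mul, hs, hc]
    rfl
  rw [e0, e0', e1, e2, e3, e4] at hsum
  linarith

/-- The transition probabilities `A i j r j / (λ r i)` of the Parry measure, where `r` is a right
Perron eigenvector of `A`. -/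
noncomputable def parryMatrix (A : Matrix (Fin a) (Fin a) ℕ) (r : Fin a → ℝ) :
    Matrix (Fin a) (Fin a) ℝ :=
  fun i j => A i j * r j / (firstEigenvalue A * r i)

/-- `μ` is a Markov measure with transition matrix `Q`, expressed on cylinders. -/
def IsMarkov (μ : Measure (SFT A)) (Q : Matrix (Fin a) (Fin a) ℝ) : Prop :=
  ∀ (n : ℕ) (w : Fin (n + 1) → Fin a) (j : Fin a),
    μ.real (cylinder A (Fin.snoc (α := fun _ => Fin a) w j)) =
      μ.real (cylinder A w) * Q (w (Fin.last n)) j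

/-- Variational principle: the conditional entropies are at most `log λ`, and equality in Gibbs'
inequality forces the transition probabilities of `parryMatrix`. -/
lemma IsParryMeasure.isMarkov (hμ : IsParryMeasure μ)
    (hl : 0 < firstEigenvalue A) {r : Fin a → ℝ} (hr : ∀ i, 0 < r i)
    (hAr : ∀ i, ∑ j, (A i j : ℝ) * r j = firstEigenvalue A * r i) :
    IsMarkov μ (parryMatrix A r) := by
  have := hμ.isProbabilityMeasure
  have hσ := hμ.measurePreserving
  intro n
  set l := firstEigenvalue A with hldef
  let P : ∀ {m : ℕ}, (Fin m → Fin a) → ℝ := fun w => μ.real (cylinder A w)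
  let s : ∀ {m : ℕ}, (Fin m → Fin a) → Fin a → (Fin (m + 1) → Fin a) :=
    fun w j => Fin.snoc (α := fun _ => Fin a) w j
  have hs : ∀ {m : ℕ} (w : Fin m → Fin a), ∑ j, P (s w j) = P w := fun w =>
    sum_real_cylinder_snoc w
  have h0 : ∀ {m : ℕ} (w : Fin m → Fin a), 0 ≤ P w := fun w => measureReal_nonneg
  have hQ0 : ∀ i j, 0 ≤ parryMatrix A r i j := fun i j =>
    div_nonneg (mul_nonneg (Nat.cast_nonneg _) (hr j).le) (mul_nonneg hl.le (hr i).le)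
  have hQ1 : ∀ i, ∑ j, parryMatrix A r i j = 1 := fun i => by
    simp only [parryMatrix, ← Finset.sum_div, hAr]
    exact div_self (mul_pos hl (hr i)).ne'
  have hadm : ∀ (w : Fin (n + 1) → Fin a) j, 0 < P (s w j) → A (w (Fin.last n)) j = 1 := by
    intro w j h
    obtain ⟨x, hx⟩ := nonempty_of_measureReal_ne_zero h.ne'
    have hx' : x ∈ cylinder A (Fin.snoc (α := fun _ => Fin a) w j) := hx
    rw [cylinder_snoc] at hx'
    have h1 := hx'.1 (Fin.last n)
    have h2 := hx'.2
    have h3 := x.2 n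
    simp only [Fin.val_last, Set.mem_ofPred_eq, Nat.cast_add, Nat.cast_one] at h1 h2
    rwa [h1, h2] at h3
  -- the two sides of the pointwise Gibbs inequality
  set G : (Fin (n + 1) → Fin a) → Fin a → ℝ := fun w j =>
    P (s w j) * (Real.log (P (s w j)) - Real.log (P w * parryMatrix A r (w (Fin.last n)) j)) with hG
  have hzero : ∀ (w : Fin (n + 1) → Fin a) j,
      P w * parryMatrix A r (w (Fin.last n)) j = 0 → P (s w j) = 0 := by
    intro w j h
    by_contra hne
    have hpos : 0 < P (s w j) := (h0 _).lt_of_ne (Ne.symm hne)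
    have hw : 0 < P w := hpos.trans_le (real_cylinder_snoc_le _ _)
    have hQ : 0 < parryMatrix A r (w (Fin.last n)) j := by
      simp only [parryMatrix, hadm w j hpos, Nat.cast_one, one_mul]
      exact div_pos (hr j) (mul_pos hl (hr _))
    exact (mul_pos hw hQ).ne' h
  have hgibbs : ∀ w j, P (s w j) - P w * parryMatrix A r (w (Fin.last n)) j ≤ G w j := fun w j =>
    sub_le_mul_log_sub_log (h0 _) (mul_nonneg (h0 _) (hQ0 _ _)) (hzero w j)
  have hmass : ∑ w, ∑ j, (P (s w j) - P w * parryMatrix A r (w (Fin.last n)) j) = 0 := by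
    refine Finset.sum_eq_zero fun w _ => ?_
    rw [Finset.sum_sub_distrib, hs, ← Finset.mul_sum, hQ1, mul_one, sub_self]
  have hGeq : ∀ w j, G w j = P (s w j) * Real.log (P (s w j)) - P (s w j) * Real.log (P w)
      - P (s w j) * Real.log (r j) + P (s w j) * Real.log l
      + P (s w j) * Real.log (r (w (Fin.last n))) := by
    intro w j
    rcases (h0 (s w j)).eq_or_lt with hx | hx
    · simp [hG, ← hx]
    have hw : 0 < P w := hx.trans_le (real_cylinder_snoc_le _ _)
    have h1 := hr j
    have h2 := hr (w (Fin.last n))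
    simp only [hG, parryMatrix, hadm w j hx, Nat.cast_one, one_mul, ← hldef]
    rw [Real.log_mul hw.ne' (by positivity), Real.log_div h1.ne' (by positivity),
      Real.log_mul hl.ne' h2.ne']
    ring
  have hGsum : ∑ w, ∑ j, G w j =
      -cylinderEntropy μ (n + 2) + cylinderEntropy μ (n + 1) + Real.log l := by
    simp only [hGeq, Finset.sum_add_distrib, Finset.sum_sub_distrib]
    have e1 : ∑ w : Fin (n + 1) → Fin a, ∑ j, P (s w j) * Real.log (P (s w j)) =
        -cylinderEntropy μ (n + 2) := by
      rw [← sum_mul_log_cylinder]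
      exact (Fin.sum_eq_sum_sum_snoc fun v : Fin (n + 2) → Fin a => P v * Real.log (P v)).symm
    have e2 : ∑ w : Fin (n + 1) → Fin a, ∑ j, P (s w j) * Real.log (P w) =
        -cylinderEntropy μ (n + 1) := by
      rw [← sum_mul_log_cylinder]
      simp only [← Finset.sum_mul, hs]
      rfl
    -- by stationarity the terms with `log r` cancel
    have e3 : ∑ w : Fin (n + 1) → Fin a, ∑ j, P (s w j) * Real.log (r j) =
        ∑ w : Fin (n + 1) → Fin a, P w * Real.log (r (w (Fin.last n))) := by
      have h1 := Fin.sum_eq_sum_sum_snoc fun v : Fin (n + 2) → Fin a => P v * Real.log (r (v (Fin.last _)))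
      have h2 := Fin.sum_eq_sum_sum_cons fun v : Fin (n + 2) → Fin a => P v * Real.log (r (v (Fin.last _)))
      simp only [Fin.snoc_last] at h1
      rw [← h1, h2]
      refine Finset.sum_congr rfl fun w _ => ?_
      rw [← Fin.succ_last]
      simp only [Fin.cons_succ, ← Finset.sum_mul]
      rw [show ∑ i, P (Fin.cons (α := fun _ => Fin a) i w) = P w from
        sum_real_cylinder_cons hσ w]
    have e4 : ∑ w : Fin (n + 1) → Fin a, ∑ j, P (s w j) * Real.log l = Real.log l := by
      simp only [← Finset.sum_mul, hs]
      rw [show ∑ w : Fin (n + 1) → Fin a, P w = 1 from sum_real_cylinder _, one_mul]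
    have e5 : ∑ w : Fin (n + 1) → Fin a, ∑ j, P (s w j) * Real.log (r (w (Fin.last n))) =
        ∑ w : Fin (n + 1) → Fin a, P w * Real.log (r (w (Fin.last n))) := by
      simp only [← Finset.sum_mul, hs]
    rw [e1, e2, e3, e4, e5]
    ring
  have hle : cylinderEntropy μ (n + 1 + 1) - cylinderEntropy μ (n + 1) ≤ Real.log l := by
    have h := Finset.sum_le_sum fun w (_ : w ∈ Finset.univ) =>
      Finset.sum_le_sum fun j (_ : j ∈ Finset.univ) => hgibbs w j
    rw [hmass, hGsum] at h
    linarith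
  have heq := increment_eq_of_tendsto (cylinderEntropy_increment_antitone hσ) hμ.entropy_eq hle
  have htot : ∑ w, ∑ j, (G w j - (P (s w j) - P w * parryMatrix A r (w (Fin.last n)) j)) = 0 := by
    simp only [Finset.sum_sub_distrib] at hmass ⊢
    rw [hmass, hGsum]
    simp only [topEntropy, ← hldef] at heq
    linarith
  intro w j
  have hnn : ∀ w j, 0 ≤ G w j - (P (s w j) - P w * parryMatrix A r (w (Fin.last n)) j) :=
    fun w j => sub_nonneg.2 (hgibbs w j)
  have h1 := (Finset.sum_eq_zero_iff_of_nonneg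
    fun w _ => Finset.sum_nonneg fun j _ => hnn w j).1 htot w (Finset.mem_univ w)
  have h2 := (Finset.sum_eq_zero_iff_of_nonneg fun j _ => hnn w j).1 h1 j (Finset.mem_univ j)
  exact eq_of_mul_log_sub_log_eq (h0 _) (mul_nonneg (h0 _) (hQ0 _ _)) (hzero w j) (by linarith)

end SFT

/-! ### Convergence of powers of a primitive stochastic matrix -/

section Stochastic

variable {ι : Type*} [Fintype ι] [DecidableEq ι] {Q : Matrix ι ι ℝ} {p : ι → ℝ}

lemma stochastic_pow_nonneg (hQ : ∀ i j, 0 ≤ Q i j) (n : ℕ) (i j : ι) : 0 ≤ (Q ^ n) i j := by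
  induction n generalizing i j with
  | zero =>
    rw [pow_zero, Matrix.one_apply]
    split_ifs <;> norm_num
  | succ n ih =>
    rw [pow_succ, Matrix.mul_apply]
    exact Finset.sum_nonneg fun k _ => mul_nonneg (ih i k) (hQ k j)

lemma stochastic_pow_sum (hQ1 : ∀ i, ∑ j, Q i j = 1) (n : ℕ) (i : ι) : ∑ j, (Q ^ n) i j = 1 := by
  induction n with
  | zero => simp [Matrix.one_apply]
  | succ n ih =>
    simp only [pow_succ, Matrix.mul_apply]
    rw [Finset.sum_comm]
    simp only [← Finset.mul_sum, hQ1, mul_one, ih]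

lemma stationary_pow (hp : ∀ j, ∑ i, p i * Q i j = p j) (n : ℕ) (j : ι) :
    ∑ i, p i * (Q ^ n) i j = p j := by
  induction n generalizing j with
  | zero => simp [Matrix.one_apply]
  | succ n ih =>
    simp only [pow_succ, Matrix.mul_apply, Finset.mul_sum]
    rw [Finset.sum_comm]
    simp only [← mul_assoc, ← Finset.sum_mul, ih, hp]

lemma stationary_pos (hp0 : ∀ i, 0 ≤ p i) (hp1 : ∑ i, p i = 1)
    (hp : ∀ j, ∑ i, p i * Q i j = p j) {d : ℕ} (hd : ∀ i j, 0 < (Q ^ d) i j) (j : ι) :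
    0 < p j := by
  rw [← stationary_pow hp d j]
  obtain ⟨i, -, hi⟩ := Finset.exists_ne_zero_of_sum_ne_zero (hp1 ▸ one_ne_zero)
  exact Finset.sum_pos' (fun k _ => mul_nonneg (hp0 k) (hd k j).le)
    ⟨i, Finset.mem_univ i, mul_pos ((hp0 i).lt_of_ne (Ne.symm hi)) (hd i j)⟩

/-- Doeblin's minorization: if `Q ^ d ≥ δ p`, then the part of `Q ^ (d k)` not yet distributed
according to `p` is at most `(1 - δ) ^ k`. -/
lemma doeblin_pow_lower (hQ : ∀ i j, 0 ≤ Q i j) (hQ1 : ∀ i, ∑ j, Q i j = 1)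
    (hp1 : ∑ i, p i = 1) (hp : ∀ j, ∑ i, p i * Q i j = p j) {d : ℕ} {δ : ℝ}
    (hδ : ∀ i j, δ * p j ≤ (Q ^ d) i j) (k : ℕ) (i j : ι) :
    (1 - (1 - δ) ^ k) * p j ≤ (Q ^ (d * k)) i j := by
  induction k generalizing i with
  | zero => simpa using stochastic_pow_nonneg hQ 0 i j
  | succ k ih =>
    have h1 : (Q ^ (d * (k + 1))) i j = ∑ l, (Q ^ d) i l * (Q ^ (d * k)) l j := by
      rw [mul_add, mul_one, add_comm, pow_add, Matrix.mul_apply]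
    have h2 : ∑ l, p l * (Q ^ (d * k)) l j = p j := stationary_pow hp _ j
    calc (1 - (1 - δ) ^ (k + 1)) * p j
        = ∑ l, ((Q ^ d) i l - δ * p l) * ((1 - (1 - δ) ^ k) * p j)
            + δ * ∑ l, p l * (Q ^ (d * k)) l j := by
          rw [h2, ← Finset.sum_mul, Finset.sum_sub_distrib, ← Finset.mul_sum, hp1,
            stochastic_pow_sum hQ1]
          ring
      _ ≤ ∑ l, ((Q ^ d) i l - δ * p l) * (Q ^ (d * k)) l j
            + δ * ∑ l, p l * (Q ^ (d * k)) l j := by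
          gcongr with l _
          · exact sub_nonneg.2 (hδ i l)
          · exact ih l
      _ = (Q ^ (d * (k + 1))) i j := by
          rw [h1, Finset.mul_sum, ← Finset.sum_add_distrib]
          exact Finset.sum_congr rfl fun l _ => by ring

/-- The transition probabilities converge to the stationary ones, with a relative error that is
uniform in the states. -/
lemma stochastic_pow_tendsto [Nonempty ι] (hQ : ∀ i j, 0 ≤ Q i j) (hQ1 : ∀ i, ∑ j, Q i j = 1)
    (hp0 : ∀ i, 0 ≤ p i) (hp1 : ∑ i, p i = 1) (hp : ∀ j, ∑ i, p i * Q i j = p j) {d : ℕ}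
    (hd : ∀ i j, 0 < (Q ^ d) i j) {ε : ℝ} (hε : 0 < ε) :
    ∃ N : ℕ, ∀ n, N ≤ n → ∀ i j, |(Q ^ n) i j - p j| ≤ ε * p j := by
  have hpos := stationary_pos hp0 hp1 hp hd
  have hp_le : ∀ j, p j ≤ 1 := fun j => by
    rw [← hp1]
    exact Finset.single_le_sum (fun k _ => hp0 k) (Finset.mem_univ j)
  obtain ⟨q, -, hq⟩ := Finset.exists_min_image (Finset.univ : Finset (ι × ι))
    (fun q => (Q ^ d) q.1 q.2) Finset.univ_nonempty
  obtain ⟨j₀, -, hj₀⟩ := Finset.exists_min_image (Finset.univ : Finset ι) p Finset.univ_nonempty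
  set δ := (Q ^ d) q.1 q.2 with hδ
  have hδ0 : 0 < δ := hd _ _
  have hδ1 : δ ≤ 1 := by
    rw [← stochastic_pow_sum hQ1 d q.1]
    exact Finset.single_le_sum (fun k _ => (hd q.1 k).le) (Finset.mem_univ q.2)
  have hmin : ∀ i j, δ * p j ≤ (Q ^ d) i j := fun i j =>
    (mul_le_of_le_one_right hδ0.le (hp_le j)).trans (hq (i, j) (Finset.mem_univ _))
  have hlim : Tendsto (fun k : ℕ => (1 - δ) ^ k) atTop (𝓝 0) :=
    tendsto_pow_atTop_nhds_zero_of_lt_one (by linarith) (by linarith)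
  -- the error `η` on the lower side costs at most `η / min p` on the upper side
  have hη : 0 < ε * p j₀ := mul_pos hε (hpos j₀)
  obtain ⟨k, hk⟩ := (hlim.eventually_lt_const hη).exists
  refine ⟨d * k, fun n hn i j => ?_⟩
  obtain ⟨m, rfl⟩ := Nat.exists_eq_add_of_le hn
  have hlow : ∀ l, (1 - ε * p j₀) * p l ≤ (Q ^ (d * k + m)) i l := by
    intro l
    rw [add_comm, pow_add, Matrix.mul_apply]
    calc (1 - ε * p j₀) * p l = ∑ t, (Q ^ m) i t * ((1 - ε * p j₀) * p l) := by
          rw [← Finset.sum_mul, stochastic_pow_sum hQ1, one_mul]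
      _ ≤ _ := by
          refine Finset.sum_le_sum fun t _ =>
            mul_le_mul_of_nonneg_left ?_ (stochastic_pow_nonneg hQ m i t)
          refine le_trans ?_ (doeblin_pow_lower hQ hQ1 hp1 hp hmin k t l)
          exact mul_le_mul_of_nonneg_right (by linarith) (hp0 l)
  have hup : (Q ^ (d * k + m)) i j ≤ p j + ε * p j₀ := by
    have h1 := stochastic_pow_sum hQ1 (d * k + m) i
    have h2 : ∑ l ∈ Finset.univ.erase j, (1 - ε * p j₀) * p l ≤
        ∑ l ∈ Finset.univ.erase j, (Q ^ (d * k + m)) i l := Finset.sum_le_sum fun l _ => hlow l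
    rw [← Finset.mul_sum] at h2
    have h3 := Finset.add_sum_erase Finset.univ p (Finset.mem_univ j)
    have h4 := Finset.add_sum_erase Finset.univ (fun l => (Q ^ (d * k + m)) i l)
      (Finset.mem_univ j)
    simp only [h1] at h4
    rw [hp1] at h3
    have h5 : ∑ l ∈ Finset.univ.erase j, p l = 1 - p j := by linarith
    rw [h5] at h2
    nlinarith [mul_nonneg hη.le (hp0 j)]
  have hmj : p j₀ ≤ p j := hj₀ j (Finset.mem_univ j)
  have hm1 := mul_le_of_le_one_left (mul_nonneg hε.le (hp0 j)) (hp_le j₀)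
  rw [abs_le]
  constructor
  · have := hlow j
    linarith [mul_comm (ε * p j) (p j₀), mul_assoc ε (p j₀) (p j), mul_assoc ε (p j) (p j₀),
      mul_comm (p j₀) (p j), mul_left_comm (p j₀) ε (p j)]
  · have := mul_le_mul_of_nonneg_left hmj hε.le
    linarith

end Stochastic

/-! ### Mixing of the Parry measure -/

namespace SFT

variable {a : ℕ} {A : Matrix (Fin a) (Fin a) ℕ} {μ : Measure (SFT A)} {E F : Set (SFT A)}

/-- Membership in `E` is determined by the coordinates in `I`. -/
def DeterminedBy (E : Set (SFT A)) (I : Set ℤ) : Prop :=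
  ∀ ⦃x y : SFT A⦄, (∀ i ∈ I, x.1 i = y.1 i) → x ∈ E → y ∈ E

namespace DeterminedBy

variable {I J : Set ℤ}

lemma of_measurableSet (h : MeasurableSet[coordAlgebra A I] E) : DeterminedBy E I := by
  obtain ⟨S, -, rfl⟩ := h
  intro x y hxy hx
  have : (fun i : I => x.1 i) = fun i : I => y.1 i := funext fun i => hxy i i.2
  simpa only [Set.mem_preimage, this] using hx

lemma mono (h : DeterminedBy E I) (hIJ : I ⊆ J) : DeterminedBy E J :=
  fun _ _ hxy => h fun i hi => hxy i (hIJ hi)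

lemma inter (hE : DeterminedBy E I) (hF : DeterminedBy F I) : DeterminedBy (E ∩ F) I :=
  fun _ _ hxy hx => ⟨hE hxy hx.1, hF hxy hx.2⟩

lemma preimage (h : DeterminedBy E I) (k : ℕ) (hIJ : ∀ i ∈ I, i + k ∈ J) :
    DeterminedBy (shift^[k] ⁻¹' E) J := by
  intro x y hxy hx
  refine h (fun i hi => ?_) hx
  simpa using hxy _ (hIJ i hi)

lemma measurableSet [Finite I] (h : DeterminedBy E I) : MeasurableSet E := by
  have hE : E = (fun (x : SFT A) (i : I) => x.1 i) ⁻¹'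
      ((fun (x : SFT A) (i : I) => x.1 i) '' E) := by
    refine (Set.subset_preimage_image _ _).antisymm ?_
    rintro y ⟨x, hx, hxy⟩
    exact h (fun i hi => congrFun hxy ⟨i, hi⟩) hx
  rw [hE]
  exact (measurable_pi_lambda _ fun i => measurable_coord _) (Set.toFinite _).measurableSet

lemma coord_eq {n : ℤ} (hn : n ∈ I) (i : Fin a) : DeterminedBy {x : SFT A | x.1 n = i} I :=
  fun _ _ hxy hx => (hxy n hn).symm.trans hx

lemma cylinder {n : ℕ} (w : Fin n → Fin a) : DeterminedBy (cylinder A w) (Set.Ico 0 (n : ℤ)) :=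
  fun _ _ hxy hx i => (hxy _ ⟨by positivity, by exact_mod_cast i.2⟩).symm.trans (hx i)

/-- A set determined by the coordinates `s, …, s + n - 1` contains each cylinder over these
coordinates, or is disjoint from it. -/
lemma inter_cylinder_eq {s n : ℕ} (h : DeterminedBy E (Set.Ico (s : ℤ) (s + n)))
    (w : Fin n → Fin a) :
    E ∩ shift^[s] ⁻¹' SFT.cylinder A w = shift^[s] ⁻¹' SFT.cylinder A w ∨
      E ∩ shift^[s] ⁻¹' SFT.cylinder A w = ∅ := by
  rw [or_iff_not_imp_right, ← ne_eq, ← Set.nonempty_iff_ne_empty]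
  rintro ⟨x, hxE, hxw⟩
  refine Set.inter_eq_right.2 fun y hy => h (fun i hi => ?_) hxE
  have h1 := hxw ⟨(i - s).toNat, by have := hi.1; have := hi.2; omega⟩
  have h2 := hy ⟨(i - s).toNat, by have := hi.1; have := hi.2; omega⟩
  have h3 : ((i - s).toNat : ℤ) + s = i := by have := hi.1; omega
  simp only [shift_iterate_apply, h3] at h1 h2
  rw [h1, h2]

end DeterminedBy

lemma sum_real_inter_cylinder [IsFiniteMeasure μ] (hE : MeasurableSet E) (s n : ℕ) :
    ∑ w : Fin n → Fin a, μ.real (E ∩ shift^[s] ⁻¹' cylinder A w) = μ.real E := by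
  have h : ∀ w : Fin n → Fin a, shift^[s] ⁻¹' cylinder A w =
      {x | (fun i : Fin n => (shift^[s] x).1 (i : ℕ)) = w} := fun w => by
    ext x
    exact funext_iff.symm
  have hm : ∀ w : Fin n → Fin a, MeasurableSet (shift^[s] ⁻¹' cylinder A w) := fun w =>
    measurable_shift.iterate s (measurableSet_cylinder w)
  simp only [h] at hm ⊢
  exact sum_real_inter_eq hm hE

section Markov

variable {Q : Matrix (Fin a) (Fin a) ℝ}

lemma IsMarkov.real_inter_next [IsFiniteMeasure μ] (hM : IsMarkov μ Q) {m : ℕ} {i : Fin a}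
    (hE : DeterminedBy E (Set.Ico 0 ((m : ℤ) + 1))) (hi : E ⊆ {x | x.1 m = i}) (j : Fin a) :
    μ.real (E ∩ {x | x.1 ((m : ℤ) + 1) = j}) = μ.real E * Q i j := by
  have hEm : MeasurableSet E := hE.measurableSet
  rw [← sum_real_inter_cylinder hEm 0 (m + 1),
    ← sum_real_inter_cylinder (hEm.inter (measurableSet_coord_eq _ j)) 0 (m + 1), Finset.sum_mul]
  refine Finset.sum_congr rfl fun w _ => ?_
  rw [Set.inter_right_comm]
  have hE' : DeterminedBy E (Set.Ico ((0 : ℕ) : ℤ) ((0 : ℕ) + (m + 1 : ℕ))) := by simpa using hE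
  rcases (cylinder A w).eq_empty_or_nonempty with h0 | ⟨x, hx⟩
  · simp [h0]
  rcases hE'.inter_cylinder_eq w with h | h
  · rw [h]
    have hxE : x ∈ E := Set.inter_eq_right.1 h hx
    have hwi : w (Fin.last m) = i := (hx (Fin.last m)).symm.trans (hi hxE)
    have := hM m w j
    rw [cylinder_snoc, hwi] at this
    simpa using this
  · rw [h]
    simp

lemma IsMarkov.real_inter_coord [IsFiniteMeasure μ] (hM : IsMarkov μ Q) {m : ℕ} {i : Fin a}
    (hE : DeterminedBy E (Set.Ico 0 ((m : ℤ) + 1))) (hi : E ⊆ {x | x.1 m = i}) (g : ℕ)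
    (j : Fin a) :
    μ.real (E ∩ {x | x.1 ((m : ℤ) + g) = j}) = μ.real E * (Q ^ g) i j := by
  induction g generalizing j with
  | zero =>
    rcases eq_or_ne i j with rfl | hij
    · have : E ∩ {x | x.1 ((m : ℤ) + (0 : ℕ)) = i} = E := by simpa using hi
      rw [this]
      simp
    · have : E ∩ {x | x.1 ((m : ℤ) + (0 : ℕ)) = j} = ∅ := by
        ext x
        simp only [Nat.cast_zero, add_zero, Set.mem_inter_iff, Set.mem_empty_iff_false, iff_false]
        rintro ⟨hx, hj⟩
        exact hij ((hi hx).symm.trans hj)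
      rw [this]
      simp [hij]
  | succ g ih =>
    rw [pow_succ, Matrix.mul_apply, Finset.mul_sum]
    have hEm : MeasurableSet E := hE.measurableSet
    rw [← sum_real_inter_eq (f := fun x : SFT A => x.1 ((m : ℤ) + g))
      (fun l => measurableSet_coord_eq _ l) (hEm.inter (measurableSet_coord_eq _ j))]
    refine Finset.sum_congr rfl fun l _ => ?_
    have hdet : DeterminedBy (E ∩ {x | x.1 ((m : ℤ) + g) = l})
        (Set.Ico 0 (((m + g : ℕ) : ℤ) + 1)) :=
      (hE.mono (Set.Ico_subset_Ico_right (by push_cast; omega))).inter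
        (DeterminedBy.coord_eq (by constructor <;> push_cast <;> omega) l)
    have h := hM.real_inter_next hdet (i := l)
      (fun x hx => by simpa using hx.2) j
    rw [ih l, mul_assoc] at h
    rw [Set.inter_right_comm, ← mul_assoc, mul_assoc, ← h]
    push_cast
    simp only [add_assoc]

/-- Markov property: given the state at time `s`, the past and the future are independent. -/
lemma IsMarkov.real_inter_cylinder [IsFiniteMeasure μ] (hM : IsMarkov μ Q) {s : ℕ} {i : Fin a}
    (hE : DeterminedBy E (Set.Ico 0 ((s : ℤ) + 1))) (hi : E ⊆ {x | x.1 s = i}) {r : ℕ}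
    (v : Fin (r + 1) → Fin a) (hv : v 0 = i) :
    μ.real {x : SFT A | x.1 0 = i} * μ.real (E ∩ shift^[s] ⁻¹' cylinder A v) =
      μ.real E * μ.real (cylinder A v) := by
  induction r with
  | zero =>
    have h1 : cylinder A v = {x | x.1 0 = i} := by
      ext x
      simp [cylinder, hv]
    have h2 : E ∩ shift^[s] ⁻¹' cylinder A v = E := by
      rw [h1, Set.inter_eq_left]
      intro x hx
      simpa using hi hx
    rw [h2, h1, mul_comm]
  | succ r ih =>
    obtain ⟨w, j, rfl⟩ : ∃ (w : Fin (r + 1) → Fin a) (j : Fin a),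
        v = Fin.snoc (α := fun _ => Fin a) w j :=
      ⟨Fin.init v, v (Fin.last _), (Fin.snoc_init_self v).symm⟩
    have hw : w 0 = i := by
      rw [← hv]
      exact (Fin.snoc_castSucc (α := fun _ => Fin a) j w 0).symm
    have hdet : DeterminedBy (E ∩ shift^[s] ⁻¹' cylinder A w)
        (Set.Ico 0 (((s + r : ℕ) : ℤ) + 1)) := by
      refine (hE.mono (Set.Ico_subset_Ico_right (by push_cast; omega))).inter
        ((DeterminedBy.cylinder w).preimage s fun k hk => ?_)
      obtain ⟨h1, h2⟩ := hk
      constructor <;> push_cast at * <;> omega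
    have h := hM.real_inter_next hdet (i := w (Fin.last r))
      (fun x hx => by
        have := hx.2 (Fin.last r)
        simpa [add_comm] using this) j
    have hset : E ∩ shift^[s] ⁻¹' cylinder A (Fin.snoc (α := fun _ => Fin a) w j) =
        E ∩ shift^[s] ⁻¹' cylinder A w ∩ {x | x.1 (((s + r : ℕ) : ℤ) + 1) = j} := by
      rw [cylinder_snoc, Set.preimage_inter, Set.inter_assoc]
      congr 2
      ext x
      simp only [Set.mem_preimage, Set.mem_ofPred_eq, shift_iterate_apply]
      push_cast
      rw [show (r : ℤ) + 1 + s = s + r + 1 by ring]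
    rw [hset, h, hM r w j, ← mul_assoc, ih w hw, mul_assoc]

lemma IsMarkov.abs_real_inter_cylinder_sub_le [IsFiniteMeasure μ] (hM : IsMarkov μ Q)
    (hp : ∀ i, 0 < μ.real {x : SFT A | x.1 0 = i}) {ε : ℝ} {g : ℕ}
    (hg : ∀ i j, |(Q ^ g) i j - μ.real {x : SFT A | x.1 0 = j}| ≤
      ε * μ.real {x : SFT A | x.1 0 = j}) {m : ℕ}
    (hE : DeterminedBy E (Set.Ico 0 ((m : ℤ) + 1))) {r : ℕ} (v : Fin (r + 1) → Fin a) :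
    |μ.real (E ∩ shift^[m + g] ⁻¹' cylinder A v) - μ.real E * μ.real (cylinder A v)| ≤
      ε * (μ.real E * μ.real (cylinder A v)) := by
  have hEm : MeasurableSet E := hE.measurableSet
  have hvm : MeasurableSet (shift^[m + g] ⁻¹' cylinder A v) :=
    measurable_shift.iterate _ (measurableSet_cylinder v)
  rw [← sum_real_inter_eq (f := fun x : SFT A => x.1 m)
      (fun l => measurableSet_coord_eq _ l) (hEm.inter hvm),
    ← sum_real_inter_eq (f := fun x : SFT A => x.1 m)
      (fun l => measurableSet_coord_eq _ l) hEm, Finset.sum_mul, ← Finset.sum_sub_distrib,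
    Finset.mul_sum]
  refine (Finset.abs_sum_le_sum_abs _ _).trans (Finset.sum_le_sum fun i _ => ?_)
  set E' := E ∩ {x | x.1 m = i} with hE'
  have hdet : DeterminedBy E' (Set.Ico 0 ((m : ℤ) + 1)) :=
    hE.inter (DeterminedBy.coord_eq (by constructor <;> omega) i)
  have h1 := hM.real_inter_coord hdet Set.inter_subset_right g (v 0)
  have hdet2 : DeterminedBy (E' ∩ {x | x.1 ((m : ℤ) + g) = v 0})
      (Set.Ico 0 (((m + g : ℕ) : ℤ) + 1)) :=
    (hdet.mono (Set.Ico_subset_Ico_right (by push_cast; omega))).inter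
      (DeterminedBy.coord_eq (by constructor <;> push_cast <;> omega) _)
  have h2 := hM.real_inter_cylinder hdet2 (i := v 0) (fun x hx => by simpa using hx.2) v rfl
  have h3 : E' ∩ {x | x.1 ((m : ℤ) + g) = v 0} ∩ shift^[m + g] ⁻¹' cylinder A v =
      E ∩ shift^[m + g] ⁻¹' cylinder A v ∩ {x | x.1 m = i} := by
    ext x
    simp only [hE', Set.mem_inter_iff, Set.mem_ofPred_eq, Set.mem_preimage]
    constructor
    · rintro ⟨⟨⟨h1, h2⟩, -⟩, h3⟩
      exact ⟨⟨h1, h3⟩, h2⟩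
    · rintro ⟨⟨h1, h3⟩, h2⟩
      refine ⟨⟨⟨h1, h2⟩, ?_⟩, h3⟩
      simpa using h3 0
  rw [h3, h1] at h2
  set q := μ.real {x : SFT A | x.1 0 = v 0} with hq
  have hq0 : 0 < q := hp _
  set c := μ.real (cylinder A v)
  set e := μ.real E'
  have hc0 : 0 ≤ c := measureReal_nonneg
  have he0 : 0 ≤ e := measureReal_nonneg
  have h4 : μ.real (E ∩ shift^[m + g] ⁻¹' cylinder A v ∩ {x | x.1 m = i}) - e * c =
      e * c / q * ((Q ^ g) i (v 0) - q) := by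
    field_simp
    linarith
  rw [h4, abs_mul, abs_of_nonneg (by positivity)]
  calc e * c / q * |(Q ^ g) i (v 0) - q| ≤ e * c / q * (ε * q) :=
        mul_le_mul_of_nonneg_left (hg i (v 0)) (by positivity)
    _ = ε * (e * c) := by field_simp

/-- Quantitative mixing of a Markov measure with transition matrix `Q`: if the powers `Q ^ n`,
`n ≥ g`, are close to stationarity, then events separated by a gap of at least `g` are almost
independent. -/
lemma IsMarkov.abs_real_inter_sub_le [IsFiniteMeasure μ] (hσ : MeasurePreserving shift μ μ)
    (hM : IsMarkov μ Q) (hp : ∀ i, 0 < μ.real {x : SFT A | x.1 0 = i}) {ε : ℝ} {g : ℕ}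
    (hg : ∀ n, g ≤ n → ∀ i j, |(Q ^ n) i j - μ.real {x : SFT A | x.1 0 = j}| ≤
      ε * μ.real {x : SFT A | x.1 0 = j}) {s t s' t' : ℤ}
    (hE : DeterminedBy E (Set.Ico s t)) (hF : DeterminedBy F (Set.Ico s' t'))
    (hgap : t + g ≤ s' + 1) :
    |μ.real (E ∩ F) - μ.real E * μ.real F| ≤ ε * (μ.real E * μ.real F) := by
  have hEm : MeasurableSet E := hE.measurableSet
  have hFm : MeasurableSet F := hF.measurableSet
  -- shift all coordinates to the right, so that they become nonnegative
  set N : ℕ := (-s).toNat + (1 - t).toNat with hN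
  have hσN := hσ.iterate N
  rw [← hσN.measureReal_preimage (hEm.inter hFm).nullMeasurableSet,
    ← hσN.measureReal_preimage hEm.nullMeasurableSet,
    ← hσN.measureReal_preimage hFm.nullMeasurableSet, Set.preimage_inter]
  obtain ⟨m, hm⟩ : ∃ m : ℕ, t + N = m + 1 := ⟨(t + N - 1).toNat, by omega⟩
  obtain ⟨g', hg', hgg'⟩ : ∃ g' : ℕ, s' + N = m + g' ∧ g ≤ g' :=
    ⟨(s' + N - m).toNat, by omega, by omega⟩
  set r : ℕ := (t' - s').toNat with hr
  have hE' : DeterminedBy (shift^[N] ⁻¹' E) (Set.Ico 0 ((m : ℤ) + 1)) :=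
    hE.preimage N fun i hi => by
      obtain ⟨h1, h2⟩ := hi
      constructor <;> omega
  have hF' : DeterminedBy (shift^[N] ⁻¹' F)
      (Set.Ico ((m + g' : ℕ) : ℤ) ((m + g' : ℕ) + (r + 1 : ℕ))) :=
    hF.preimage N fun i hi => by
      obtain ⟨h1, h2⟩ := hi
      constructor <;> push_cast <;> omega
  have hE'm : MeasurableSet (shift^[N] ⁻¹' E) := hE'.measurableSet
  have hF'm : MeasurableSet (shift^[N] ⁻¹' F) := hF'.measurableSet
  set E' := shift^[N] ⁻¹' E
  set F' := shift^[N] ⁻¹' F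
  rw [← sum_real_inter_cylinder (hE'm.inter hF'm) (m + g') (r + 1),
    ← sum_real_inter_cylinder hF'm (m + g') (r + 1), Finset.mul_sum, ← Finset.sum_sub_distrib,
    Finset.mul_sum]
  refine (Finset.abs_sum_le_sum_abs _ _).trans (Finset.sum_le_sum fun v _ => ?_)
  rw [Set.inter_assoc]
  rcases hF'.inter_cylinder_eq v with h | h
  · rw [h, (hσ.iterate _).measureReal_preimage (measurableSet_cylinder v).nullMeasurableSet]
    exact hM.abs_real_inter_cylinder_sub_le hp (hg g' hgg') hE' v
  · simp [h]

end Markov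

/-- `ψ`-mixing: events separated by a long gap are independent up to a small relative error, and
events on adjacent (or overlapping in one coordinate) blocks are independent up to a constant
factor. -/
structure IsPsiMixing (μ : Measure (SFT A)) : Prop where
  abs_sub_le : ∀ ε : ℝ, 0 < ε → ∃ g : ℕ, ∀ (E F : Set (SFT A)) (s t s' t' : ℤ),
    DeterminedBy E (Set.Ico s t) → DeterminedBy F (Set.Ico s' t') → t + g ≤ s' + 1 →
      |μ.real (E ∩ F) - μ.real E * μ.real F| ≤ ε * (μ.real E * μ.real F)
  le_mul : ∃ K : ℝ, 0 ≤ K ∧ ∀ (E F : Set (SFT A)) (s t s' t' : ℤ),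
    DeterminedBy E (Set.Ico s t) → DeterminedBy F (Set.Ico s' t') → t ≤ s' + 1 →
      μ.real (E ∩ F) ≤ K * (μ.real E * μ.real F)

lemma parryMatrix_pow_apply {r : Fin a → ℝ} (hr : ∀ i, 0 < r i) (hl : 0 < firstEigenvalue A)
    (n : ℕ) (i j : Fin a) :
    (parryMatrix A r ^ n) i j = (A ^ n) i j * r j / (firstEigenvalue A ^ n * r i) := by
  induction n generalizing j with
  | zero =>
    rcases eq_or_ne i j with rfl | h
    · simp [(hr i).ne']
    · simp [h]
  | succ n ih =>
    rw [pow_succ, pow_succ, Matrix.mul_apply, Matrix.mul_apply, Nat.cast_sum, Finset.sum_mul,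
      Finset.sum_div]
    refine Finset.sum_congr rfl fun k _ => ?_
    rw [ih, parryMatrix]
    have h1 := hr k
    have h2 := hr i
    push_cast
    field_simp
    ring

theorem IsParryMeasure.isPsiMixing (ha : 2 ≤ a) (hA : IsTransitionMatrix A)
    (hμ : IsParryMeasure μ) : IsPsiMixing μ := by
  have := hμ.isProbabilityMeasure
  have hσ := hμ.measurePreserving
  have : Nonempty (Fin a) := ⟨⟨0, by omega⟩⟩
  obtain ⟨hl, r, hr, hAr⟩ := exists_perron ha hA
  have hM := hμ.isMarkov hl hr hAr
  set Q := parryMatrix A r with hQdef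
  set p : Fin a → ℝ := fun i => μ.real {x : SFT A | x.1 0 = i} with hpdef
  have hQ0 : ∀ i j, 0 ≤ Q i j := fun i j =>
    div_nonneg (mul_nonneg (Nat.cast_nonneg _) (hr j).le) (mul_nonneg hl.le (hr i).le)
  have hQ1 : ∀ i, ∑ j, Q i j = 1 := fun i => by
    simp only [hQdef, parryMatrix, ← Finset.sum_div, hAr]
    exact div_self (mul_pos hl (hr i)).ne'
  have hp0 : ∀ i, 0 ≤ p i := fun i => measureReal_nonneg
  have hp1 : ∑ i, p i = 1 := by
    have h := sum_real_inter_eq (ν := μ) (f := fun x : SFT A => x.1 0)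
      (fun i => measurableSet_coord_eq _ i) MeasurableSet.univ
    simpa using h
  have hp : ∀ j, ∑ i, p i * Q i j = p j := by
    intro j
    have h : ∀ i, p i * Q i j = μ.real ({x : SFT A | x.1 1 = j} ∩ {x | x.1 0 = i}) := by
      intro i
      have h := hM.real_inter_next (E := {x : SFT A | x.1 0 = i}) (m := 0) (i := i)
        (DeterminedBy.coord_eq (by simp) i) (by simp) j
      rw [Set.inter_comm]
      simpa using h.symm
    simp only [h]
    rw [sum_real_inter_eq (f := fun x : SFT A => x.1 0) (fun i => measurableSet_coord_eq _ i)
      (measurableSet_coord_eq _ _)]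
    exact hσ.measureReal_preimage (measurableSet_coord_eq 0 j).nullMeasurableSet
  obtain ⟨d, hd⟩ := hA.exists_pow_pos
  have hQd : ∀ i j, 0 < (Q ^ d) i j := fun i j => by
    rw [parryMatrix_pow_apply hr hl]
    exact div_pos (mul_pos (Nat.cast_pos.2 (hd i j)) (hr j)) (mul_pos (pow_pos hl d) (hr i))
  have hppos := stationary_pos hp0 hp1 hp hQd
  constructor
  · intro ε hε
    obtain ⟨g, hg⟩ := stochastic_pow_tendsto hQ0 hQ1 hp0 hp1 hp hQd hε
    exact ⟨g, fun E F s t s' t' hE hF hgap => hM.abs_real_inter_sub_le hσ hppos hg hE hF hgap⟩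
  · -- all transition probabilities are at most `1 ≤ p j / min p`
    obtain ⟨i₀, -, hi₀⟩ := Finset.exists_min_image (Finset.univ : Finset (Fin a)) p
      Finset.univ_nonempty
    refine ⟨1 + 1 / p i₀, by have := hppos i₀; positivity, fun E F s t s' t' hE hF hgap => ?_⟩
    have hg : ∀ n, 0 ≤ n → ∀ i j, |(Q ^ n) i j - p j| ≤ 1 / p i₀ * p j := by
      intro n _ i j
      have h1 : 1 ≤ 1 / p i₀ * p j := by
        rw [one_div_mul_eq_div, one_le_div (hppos i₀)]
        exact hi₀ j (Finset.mem_univ j)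
      have h2 : (Q ^ n) i j ≤ 1 := by
        rw [← stochastic_pow_sum hQ1 n i]
        exact Finset.single_le_sum (fun k _ => stochastic_pow_nonneg hQ0 n i k)
          (Finset.mem_univ j)
      have h3 : p j ≤ 1 := by
        rw [← hp1]
        exact Finset.single_le_sum (fun k _ => hp0 k) (Finset.mem_univ j)
      rw [abs_le]
      constructor <;> linarith [stochastic_pow_nonneg hQ0 n i j, hp0 j]
    have h := hM.abs_real_inter_sub_le hσ hppos hg hE hF (by simpa using hgap)
    linarith [(abs_le.1 h).2]

end SFT

/-! ### From approximate independence of the past to the exponential law -/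

/-- A sequence whose increments are nearly those of the geometric sequence `(1 - u) ^ k` stays close
to it, uniformly in `k`: the errors `δ u` are summed with the weights `(1 - u) ^ j`. -/
lemma abs_sub_geometric_le {F : ℕ → ℝ} {u δ : ℝ} (hu1 : u ≤ 1) (hδ : 0 ≤ δ)
    (h0 : F 0 = 1) (h : ∀ k, |F (k + 1) - (1 - u) * F k| ≤ δ * u) (k : ℕ) :
    |F k - (1 - u) ^ k| ≤ δ := by
  induction k with
  | zero => simpa [h0] using hδ
  | succ k ih =>
    have h1 : F (k + 1) - (1 - u) ^ (k + 1) =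
        (F (k + 1) - (1 - u) * F k) + (1 - u) * (F k - (1 - u) ^ k) := by ring
    rw [h1]
    refine (abs_add_le _ _).trans ?_
    rw [abs_mul, abs_of_nonneg (sub_nonneg.2 hu1)]
    have h2 := mul_le_mul_of_nonneg_left ih (sub_nonneg.2 hu1)
    linarith [h k]

lemma tendsto_one_sub_pow_floor {u : ℕ → ℝ} (hu : ∀ n, 0 < u n) (hu1 : ∀ n, u n ≤ 1)
    (hlim : Tendsto u atTop (𝓝 0)) {t : ℝ} (ht : 0 ≤ t) :
    Tendsto (fun n => (1 - u n) ^ ⌊t / u n⌋₊) atTop (𝓝 (Real.exp (-t))) := by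
  have hfl : Tendsto (fun n => (⌊t / u n⌋₊ : ℝ) * u n) atTop (𝓝 t) := by
    refine tendsto_of_tendsto_of_tendsto_of_le_of_le (g := fun n => t - u n) (h := fun _ => t)
      (by simpa using hlim.const_sub t) tendsto_const_nhds (fun n => ?_) (fun n => ?_)
    · have h := mul_lt_mul_of_pos_right (Nat.lt_floor_add_one (t / u n)) (hu n)
      rw [div_mul_cancel₀ _ (hu n).ne'] at h
      simp only
      linarith
    · have h := mul_le_mul_of_nonneg_right (Nat.floor_le (div_nonneg ht (hu n).le)) (hu n).le
      rwa [div_mul_cancel₀ _ (hu n).ne'] at h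
  have hexp : Tendsto (fun n => Real.exp (-((⌊t / u n⌋₊ : ℝ) * u n))) atTop
      (𝓝 (Real.exp (-t))) := (Real.continuous_exp.tendsto _).comp hfl.neg
  -- the sequence `exp (-k u)` has nearly geometric increments
  have hclose : ∀ n (k : ℕ), |Real.exp (-((k : ℝ) * u n)) - (1 - u n) ^ k| ≤ u n := by
    intro n k
    refine abs_sub_geometric_le (F := fun k : ℕ => Real.exp (-((k : ℝ) * u n))) (hu1 n) (hu n).le
      (by simp) (fun k => ?_) k
    have h1 : Real.exp (-(((k + 1 : ℕ) : ℝ) * u n)) - (1 - u n) * Real.exp (-((k : ℝ) * u n)) =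
        Real.exp (-((k : ℝ) * u n)) * (Real.exp (-u n) - 1 - -u n) := by
      push_cast
      rw [show -(((k : ℝ) + 1) * u n) = -((k : ℝ) * u n) + -u n by ring, Real.exp_add]
      ring
    rw [h1, abs_mul, abs_of_pos (Real.exp_pos _)]
    have h2 := Real.abs_exp_sub_one_sub_id_le (x := -u n)
      (by rw [abs_neg, abs_of_pos (hu n)]; exact hu1 n)
    have h3 : Real.exp (-((k : ℝ) * u n)) ≤ 1 :=
      Real.exp_le_one_iff.2 (neg_nonpos.2 (mul_nonneg (Nat.cast_nonneg k) (hu n).le))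
    calc _ ≤ 1 * (-u n) ^ 2 := mul_le_mul h3 h2 (abs_nonneg _) zero_le_one
      _ = u n * u n := by ring
  have hdiff : Tendsto (fun n => Real.exp (-((⌊t / u n⌋₊ : ℝ) * u n)) -
      (1 - u n) ^ ⌊t / u n⌋₊) atTop (𝓝 0) :=
    squeeze_zero_norm (fun n => hclose n _) hlim
  simpa using hexp.sub hdiff

namespace SFT

variable {a : ℕ} {A : Matrix (Fin a) (Fin a) ℕ} {μ : Measure (SFT A)} {U : Set (SFT A)}

/-- The points which do not enter `U` at the times `1, …, k`. -/
def noEntry (U : Set (SFT A)) (k : ℕ) : Set (SFT A) :=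
  {x | ∀ j, 1 ≤ j → j ≤ k → shift^[j] x ∉ U}

/-- The points which do not visit `U` at the times `0, …, k - 1`. -/
def noVisit (U : Set (SFT A)) (k : ℕ) : Set (SFT A) :=
  {x | ∀ j, j < k → shift^[j] x ∉ U}

lemma entryTime_le_iff {x : SFT A} {k : ℕ} :
    entryTime U x ≤ k ↔ ∃ j, 1 ≤ j ∧ j ≤ k ∧ shift^[j] x ∈ U := by
  constructor
  · intro h
    have h1 : entryTime U x < ((k + 1 : ℕ) : ℕ∞) := h.trans_lt (by exact_mod_cast Nat.lt_succ_self k)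
    obtain ⟨_, ⟨j, hj1, hj, rfl⟩, hlt⟩ := sInf_lt_iff.1 h1
    exact ⟨j, hj1, Nat.lt_succ_iff.1 (by exact_mod_cast hlt), hj⟩
  · rintro ⟨j, hj1, hjk, hj⟩
    have h : entryTime U x ≤ j := sInf_le ⟨j, hj1, hj, rfl⟩
    exact h.trans (Nat.cast_le.2 hjk)

lemma setOf_entryTime_le (U : Set (SFT A)) (k : ℕ) : {x | entryTime U x ≤ k} = (noEntry U k)ᶜ := by
  ext x
  simp [entryTime_le_iff, noEntry]

lemma measurableSet_noVisit (hU : MeasurableSet U) (k : ℕ) : MeasurableSet (noVisit U k) := by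
  have h : noVisit U k = ⋂ j, ⋂ (_ : j < k), (shift^[j] ⁻¹' U)ᶜ := by
    ext x
    simp [noVisit]
  rw [h]
  exact MeasurableSet.iInter fun j => MeasurableSet.iInter fun _ =>
    (measurable_shift.iterate j hU).compl

lemma noEntry_eq_preimage (U : Set (SFT A)) (k : ℕ) : noEntry U k = shift ⁻¹' noVisit U k := by
  ext x
  constructor
  · intro h j hj
    rw [← Function.iterate_succ_apply]
    exact h (j + 1) (by omega) (by omega)
  · intro h j hj1 hjk
    obtain ⟨i, rfl⟩ := Nat.exists_eq_add_of_le' hj1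
    rw [Function.iterate_succ_apply]
    exact h i (by omega)

lemma noVisit_succ (U : Set (SFT A)) (k : ℕ) : noVisit U (k + 1) = noEntry U k \ U := by
  ext x
  constructor
  · intro h
    exact ⟨fun j _ hjk => h j (by omega), h 0 (by omega)⟩
  · rintro ⟨h, h0⟩ j hj
    rcases Nat.eq_zero_or_pos j with rfl | hj0
    · exact h0
    · exact h j hj0 (by omega)

lemma measurableSet_noEntry (hU : MeasurableSet U) (k : ℕ) : MeasurableSet (noEntry U k) := by
  rw [noEntry_eq_preimage]
  exact measurable_shift (measurableSet_noVisit hU k)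

/-- Stationarity: the event that the first entry occurs at time `k + 1` has the same measure as the
event of starting in `U` and not returning up to time `k`. -/
lemma real_noEntry_succ [IsFiniteMeasure μ] (hσ : MeasurePreserving shift μ μ)
    (hU : MeasurableSet U) (k : ℕ) :
    μ.real (noEntry U (k + 1)) = μ.real (noEntry U k) - μ.real (U ∩ noEntry U k) := by
  rw [noEntry_eq_preimage U (k + 1),
    hσ.measureReal_preimage (measurableSet_noVisit hU _).nullMeasurableSet, noVisit_succ,
    Set.inter_comm U, ← measureReal_inter_add_sdiff (s := noEntry U k) hU, add_sub_cancel_left]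

lemma DeterminedBy.noVisit {s t : ℤ} (h : DeterminedBy U (Set.Ico s t)) (k : ℕ) :
    DeterminedBy (noVisit U k) (Set.Ico s (t + k)) := by
  intro x y hxy hx j hj hy
  refine hx j hj (h.preimage j (J := Set.Ico s (t + k)) (fun i hi => ?_) (x := y) (y := x)
    (fun i hi => (hxy i hi).symm) hy)
  obtain ⟨h1, h2⟩ := hi
  constructor <;> omega

/-- Short returns are rare by hypothesis, and after a gap the mixing property applies; hence
starting in `U` hardly influences the later entries into `U`. -/
lemma abs_real_inter_noEntry_sub_le [IsProbabilityMeasure μ] (hσ : MeasurePreserving shift μ μ)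
    {ε K e : ℝ} {g n : ℕ} (hε : 0 ≤ ε) (hn : 1 ≤ n)
    (hg : ∀ (E F : Set (SFT A)) (s t s' t' : ℤ),
      DeterminedBy E (Set.Ico s t) → DeterminedBy F (Set.Ico s' t') → t + g ≤ s' + 1 →
        |μ.real (E ∩ F) - μ.real E * μ.real F| ≤ ε * (μ.real E * μ.real F))
    (hU : DeterminedBy U (Set.Ico (-(n : ℤ)) n)) (hK : 0 ≤ K) (hUe : μ.real U ≤ e)
    (hret : ∀ j, 1 ≤ j → μ.real (U ∩ shift^[j] ⁻¹' U) ≤ K * (e * μ.real U)) (k : ℕ) :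
    |μ.real (U ∩ noEntry U k) - μ.real U * μ.real (noEntry U k)| ≤
      (ε + (2 * n + g) * ((K + 1) * e)) * μ.real U := by
  set T : ℕ := 2 * n + g with hT
  have hUm : MeasurableSet U := hU.measurableSet
  have hu0 : 0 ≤ μ.real U := measureReal_nonneg
  have he0 : 0 ≤ e := hu0.trans hUe
  set B := shift^[T] ⁻¹' noVisit U (k + 1 - T) with hB
  have hBm : MeasurableSet B := measurable_shift.iterate T (measurableSet_noVisit hUm _)
  have hsub : noEntry U k ⊆ B := by
    intro x hx j hj
    rw [← Function.iterate_add_apply]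
    exact hx (j + T) (by omega) (by omega)
  have hcover : B ⊆ noEntry U k ∪ ⋃ j ∈ Finset.Ico 1 T, shift^[j] ⁻¹' U := by
    intro x hx
    by_contra hne
    simp only [Set.mem_union, Set.mem_iUnion, not_or, not_exists, Finset.mem_Ico] at hne
    refine hne.1 fun j hj1 hjk hj => ?_
    rcases lt_or_ge j T with h | h
    · exact hne.2 j ⟨hj1, h⟩ hj
    · have := hx (j - T) (by omega)
      rw [← Function.iterate_add_apply, Nat.sub_add_cancel h] at this
      exact this hj
  have h1 : |μ.real (U ∩ B) - μ.real U * μ.real B| ≤ ε * μ.real U := by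
    refine (hg U B _ _ (n + g : ℤ) (n + g + (n + (k + 1 - T : ℕ)) + n) hU ?_ (by omega)).trans ?_
    · refine (hU.noVisit (k + 1 - T)).preimage T fun i hi => ?_
      obtain ⟨h1, h2⟩ := hi
      constructor <;> omega
    · exact mul_le_mul_of_nonneg_left (mul_le_of_le_one_right hu0 measureReal_le_one) hε
  have hT0 : (0 : ℝ) ≤ T := Nat.cast_nonneg T
  have hcard : ((Finset.Ico 1 T).card : ℝ) ≤ T := by
    exact_mod_cast (by simp : (Finset.Ico 1 T).card ≤ T)
  have h2 : μ.real B ≤ μ.real (noEntry U k) + T * e := by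
    refine (measureReal_mono hcover).trans ((measureReal_union_le _ _).trans ?_)
    gcongr
    refine (measureReal_biUnion_finset_le _ _).trans ?_
    refine (Finset.sum_le_card_nsmul _ _ e fun j _ => ?_).trans ?_
    · rwa [(hσ.iterate j).measureReal_preimage hUm.nullMeasurableSet]
    · rw [nsmul_eq_mul]
      gcongr
  have h3 : μ.real (U ∩ B) ≤ μ.real (U ∩ noEntry U k) + T * (K * (e * μ.real U)) := by
    have hc : U ∩ B ⊆ (U ∩ noEntry U k) ∪ ⋃ j ∈ Finset.Ico 1 T, (U ∩ shift^[j] ⁻¹' U) := by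
      rintro x ⟨hxU, hxB⟩
      rcases hcover hxB with h | h
      · exact Or.inl ⟨hxU, h⟩
      · simp only [Set.mem_iUnion] at h
        obtain ⟨j, hj, hjx⟩ := h
        exact Or.inr (Set.mem_biUnion (Finset.mem_coe.2 hj) ⟨hxU, hjx⟩)
    refine (measureReal_mono hc).trans ((measureReal_union_le _ _).trans ?_)
    gcongr
    refine (measureReal_biUnion_finset_le _ _).trans ?_
    refine (Finset.sum_le_card_nsmul _ _ (K * (e * μ.real U)) fun j hj =>
      hret j (Finset.mem_Ico.1 hj).1).trans ?_
    rw [nsmul_eq_mul]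
    gcongr
  have h4 : μ.real (noEntry U k) ≤ μ.real B := measureReal_mono hsub
  have h5 : μ.real (U ∩ noEntry U k) ≤ μ.real (U ∩ B) :=
    measureReal_mono (Set.inter_subset_inter_right _ hsub)
  have h6 := mul_le_mul_of_nonneg_left h2 hu0
  have h7 := mul_le_mul_of_nonneg_left h4 hu0
  have h8 := abs_le.1 h1
  have hTc : (2 * n + g : ℝ) = T := by rw [hT]; push_cast; ring
  have h9 : 0 ≤ T * (e * μ.real U) := by positivity
  have h10 : 0 ≤ T * (K * (e * μ.real U)) := by positivity
  rw [hTc, abs_le]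
  constructor <;> nlinarith

/-- The exponential law, from mixing and a bound `e n = o(1 / n)` which controls both the measure
of `U n` and the probabilities of returns. -/
theorem convergesInLaw_of_rare_returns (hμ : IsParryMeasure μ) (hψ : IsPsiMixing μ)
    {U : ℕ → Set (SFT A)} (hU : ∀ n, DeterminedBy (U n) (Set.Ico (-(n : ℤ)) n))
    (hpos : ∀ n, 0 < μ (U n)) {e : ℕ → ℝ} {K : ℝ} (hK : 0 ≤ K)
    (he : Tendsto (fun n : ℕ => (n : ℝ) * e n) atTop (𝓝 0))
    (hUe : ∀ n, 1 ≤ n → μ.real (U n) ≤ e n)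
    (hret : ∀ n, 1 ≤ n → ∀ j, 1 ≤ j →
      μ.real (U n ∩ shift^[j] ⁻¹' U n) ≤ K * (e n * μ.real (U n))) :
    ConvergesInLawToExpOne μ (fun n => rescaledEntryTime μ (U n)) := by
  have := hμ.isProbabilityMeasure
  have hσ := hμ.measurePreserving
  have hUm : ∀ n, MeasurableSet (U n) := fun n => (hU n).measurableSet
  have hu : ∀ n, 0 < μ.real (U n) := fun n => ENNReal.toReal_pos (hpos n).ne' (measure_ne_top _ _)
  have hu1 : ∀ n, μ.real (U n) ≤ 1 := fun n => measureReal_le_one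
  have he' : Tendsto e atTop (𝓝 0) := by
    refine squeeze_zero' ?_ ?_ he
    · filter_upwards [eventually_ge_atTop 1] with n hn
      exact (hu n).le.trans (hUe n hn)
    · filter_upwards [eventually_ge_atTop 1] with n hn
      exact le_mul_of_one_le_left ((hu n).le.trans (hUe n hn)) (by exact_mod_cast hn)
  have hulim : Tendsto (fun n => μ.real (U n)) atTop (𝓝 0) := by
    refine squeeze_zero' (Eventually.of_forall fun n => (hu n).le) ?_ he'
    filter_upwards [eventually_ge_atTop 1] with n hn using hUe n hn
  -- the survival function of the entry time is uniformly close to a geometric sequence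
  have hunif : ∀ ε : ℝ, 0 < ε → ∀ᶠ n in atTop, ∀ k : ℕ,
      |μ.real (noEntry (U n) k) - (1 - μ.real (U n)) ^ k| ≤ ε := by
    intro ε hε
    obtain ⟨g, hg⟩ := hψ.abs_sub_le (ε / 2) (half_pos hε)
    have hlim : Tendsto (fun n : ℕ => (2 * n + g : ℝ) * ((K + 1) * e n)) atTop (𝓝 0) := by
      have h := ((he.const_mul (2 * (K + 1))).add (he'.const_mul (g * (K + 1))))
      simp only [mul_zero, add_zero] at h
      refine h.congr fun n => ?_
      ring
    filter_upwards [hlim.eventually_lt_const (half_pos hε), eventually_ge_atTop 1] with n hn hn1 k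
    refine abs_sub_geometric_le (F := fun k => μ.real (noEntry (U n) k)) (hu1 n) hε.le ?_ (fun k => ?_) k
    · have : noEntry (U n) 0 = Set.univ := by
        ext x
        simp only [noEntry, Set.mem_ofPred_eq, Set.mem_univ, iff_true]
        intro j h1 h2
        omega
      simp [this]
    · have h1 := abs_real_inter_noEntry_sub_le hσ (half_pos hε).le hn1 hg (hU n) hK (hUe n hn1)
        (hret n hn1) k
      rw [real_noEntry_succ hσ (hUm n), abs_sub_comm]
      have h2 : (1 - μ.real (U n)) * μ.real (noEntry (U n) k) -
          (μ.real (noEntry (U n) k) - μ.real (U n ∩ noEntry (U n) k)) =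
          μ.real (U n ∩ noEntry (U n) k) - μ.real (U n) * μ.real (noEntry (U n) k) := by ring
      rw [h2]
      exact h1.trans (mul_le_mul_of_nonneg_right (by linarith) (hu n).le)
  intro t
  split_ifs with ht
  · have hset : ∀ n, {x | ((rescaledEntryTime μ (U n) x : ℝ≥0∞) : EReal) ≤ (t : EReal)} =
        (noEntry (U n) ⌊t / μ.real (U n)⌋₊)ᶜ := by
      intro n
      rw [← setOf_entryTime_le]
      ext x
      simp only [Set.mem_ofPred_eq, rescaledEntryTime]
      rcases eq_or_ne (entryTime (U n) x) ⊤ with htop | htop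
      · simp [htop, ENNReal.mul_top (hpos n).ne']
      · obtain ⟨m, hm⟩ := ENat.ne_top_iff_exists.1 htop
        rw [← hm]
        have h1 : μ (U n) * ((m : ℕ∞) : ℝ≥0∞) = ENNReal.ofReal (μ.real (U n) * m) := by
          rw [ENNReal.ofReal_mul measureReal_nonneg, ofReal_measureReal]
          simp
        rw [h1, EReal.coe_ennreal_ofReal, max_eq_left (by positivity), EReal.coe_le_coe_iff,
          Nat.cast_le, Nat.le_floor_iff (div_nonneg ht (hu n).le), le_div_iff₀ (hu n), mul_comm]
    simp only [hset]
    have hF : Tendsto (fun n => μ.real (noEntry (U n) ⌊t / μ.real (U n)⌋₊)) atTop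
        (𝓝 (Real.exp (-t))) := by
      have h1 := tendsto_one_sub_pow_floor hu hu1 hulim ht
      have h2 : Tendsto (fun n => μ.real (noEntry (U n) ⌊t / μ.real (U n)⌋₊) -
          (1 - μ.real (U n)) ^ ⌊t / μ.real (U n)⌋₊) atTop (𝓝 0) := by
        rw [Metric.tendsto_nhds]
        intro ε hε
        filter_upwards [hunif (ε / 2) (half_pos hε)] with n hn
        rw [dist_zero_right, Real.norm_eq_abs]
        exact (hn _).trans_lt (half_lt_self hε)
      simpa using h2.add h1
    have h3 := ENNReal.tendsto_ofReal (hF.const_sub 1)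
    refine h3.congr fun n => ?_
    rw [← ofReal_measureReal (μ := μ), measureReal_compl (measurableSet_noEntry (hUm n) _),
      probReal_univ]
  · have hset : ∀ n, {x | ((rescaledEntryTime μ (U n) x : ℝ≥0∞) : EReal) ≤ (t : EReal)} = ∅ := by
      intro n
      ext x
      simp only [Set.mem_ofPred_eq, Set.mem_empty_iff_false, iff_false, not_le]
      exact (EReal.coe_lt_coe_iff.2 (not_le.1 ht)).trans_le (EReal.coe_ennreal_nonneg _)
    simp [hset]

end SFT

/-! ### Return times and the three conditions -/

/-- If `b` decreases and `h n ≤ n + c`, then `b (h n) = o(1 / n)` implies `b n = o(1 / n)`. -/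
lemma tendsto_mul_of_antitone {b : ℕ → ℝ} (hb : Antitone b) (hb0 : ∀ n, 0 ≤ b n) {h : ℕ → ℕ}
    {c : ℕ} (hh : ∀ n, 1 ≤ n → h n ≤ n + c)
    (hlim : Tendsto (fun n : ℕ => (n : ℝ) * b (h n)) atTop (𝓝 0)) :
    Tendsto (fun n : ℕ => (n : ℝ) * b n) atTop (𝓝 0) := by
  have h1 := ((hlim.comp (tendsto_sub_atTop_nat c)).const_mul 2)
  simp only [mul_zero] at h1
  refine squeeze_zero' (Eventually.of_forall fun n => mul_nonneg (Nat.cast_nonneg n) (hb0 n))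
    ?_ h1
  filter_upwards [eventually_ge_atTop (2 * c + 1)] with n hn
  have h2 : b n ≤ b (h (n - c)) := hb (by have := hh (n - c) (by omega); omega)
  have h3 : (n : ℝ) ≤ 2 * ((n - c : ℕ) : ℝ) := by
    exact_mod_cast (by omega : n ≤ 2 * (n - c))
  simp only [Function.comp_apply]
  rw [← mul_assoc]
  exact mul_le_mul h3 h2 (hb0 n) (by positivity)

/-- Replacing the index `h n` by `min (h n) n` keeps the rate `o(1 / n)`. -/
lemma tendsto_mul_min {b : ℕ → ℝ} (hb : Antitone b) (hb0 : ∀ n, 0 ≤ b n) {h : ℕ → ℕ}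
    {c : ℕ} (hh : ∀ n, 1 ≤ n → h n ≤ n + c)
    (hlim : Tendsto (fun n : ℕ => (n : ℝ) * b (h n)) atTop (𝓝 0)) :
    Tendsto (fun n : ℕ => (n : ℝ) * b (min (h n) n)) atTop (𝓝 0) := by
  have h1 := hlim.add (tendsto_mul_of_antitone hb hb0 hh hlim)
  rw [add_zero] at h1
  refine squeeze_zero (fun n => mul_nonneg (Nat.cast_nonneg n) (hb0 _)) (fun n => ?_) h1
  rw [← mul_add]
  refine mul_le_mul_of_nonneg_left ?_ (Nat.cast_nonneg n)
  rcases min_choice (h n) n with h2 | h2 <;> rw [h2]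
  · exact le_add_of_nonneg_right (hb0 _)
  · exact le_add_of_nonneg_left (hb0 _)

namespace SFT

variable {a : ℕ} {A : Matrix (Fin a) (Fin a) ℕ} {μ : Measure (SFT A)} {U V : Set (SFT A)}

lemma returnTime_le {j : ℕ} (hj : 1 ≤ j) (h : (U ∩ shift^[j] ⁻¹' U).Nonempty) :
    returnTime U ≤ j := by
  obtain ⟨x, hx, hxj⟩ := h
  exact (sInf_le (Set.mem_image_of_mem _ hx)).trans (entryTime_le_iff.2 ⟨j, hj, le_rfl, hxj⟩)

lemma two_mul_halfReturn_le {j : ℕ} (h : returnTime U ≤ j) : 2 * halfReturn U ≤ j := by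
  have h1 := ENat.toNat_le_of_le_natCast h
  have h2 : halfReturn U = (returnTime U).toNat / 2 := rfl
  omega

/-- By mixing, a set determined by the coordinates `-n, …, n - 1` meets its image under all
sufficiently long translations; the excess over `2 n` is bounded. -/
lemma IsPsiMixing.exists_returnTime_le [IsProbabilityMeasure μ] (hψ : IsPsiMixing μ)
    (hσ : MeasurePreserving shift μ μ) :
    ∃ g : ℕ, ∀ (n : ℕ) (U : Set (SFT A)), 1 ≤ n → DeterminedBy U (Set.Ico (-(n : ℤ)) n) →
      0 < μ U → returnTime U ≤ ((2 * n + g : ℕ) : ℕ∞) := by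
  obtain ⟨g, hg⟩ := hψ.abs_sub_le (1 / 2) (by norm_num)
  refine ⟨g, fun n U hn hU hpos => returnTime_le (by omega) ?_⟩
  have hUm : MeasurableSet U := hU.measurableSet
  have hu : 0 < μ.real U := ENNReal.toReal_pos hpos.ne' (measure_ne_top _ _)
  have h := hg U (shift^[2 * n + g] ⁻¹' U) _ _ (n + g : ℤ) (3 * n + g) hU
    (hU.preimage _ fun i hi => by
      obtain ⟨h1, h2⟩ := hi
      constructor <;> push_cast <;> omega) (by omega)
  rw [(hσ.iterate _).measureReal_preimage hUm.nullMeasurableSet] at h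
  have h1 := (abs_le.1 h).1
  have h2 : 0 < μ.real U * μ.real U := mul_pos hu hu
  exact nonempty_of_measureReal_ne_zero (μ := μ) (by intro h0; rw [h0] at h1; linarith)

end SFT

theorem theorem1 {a : ℕ} (ha : 2 ≤ a) (A : Matrix (Fin a) (Fin a) ℕ) (hA : IsTransitionMatrix A)
    (μ : Measure (SFT A)) (hμ : SFT.IsParryMeasure μ)
    (U : ℕ → Set (SFT A))
    (hU : ∀ n : ℕ, MeasurableSet[SFT.coordAlgebra A (Set.Ico (-(n : ℤ)) (n : ℤ))] (U n))
    (hpos : ∀ n : ℕ, 0 < μ (U n))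
    (h :
      -- condition (i)
      ((∀ n : ℕ, 0 < n →
          SFT.shift^[n + 1] ⁻¹' U (n + 1) ⊆ SFT.shift^[n] ⁻¹' U n) ∧
        Tendsto (fun n : ℕ => (n : ℝ) * μ.real (U (SFT.halfReturn (U n)))) atTop (𝓝 0)) ∨
      -- condition (ii)
      (∃ k : ℕ → ℕ, Monotone k ∧
        (∀ n : ℕ, 1 ≤ n → SFT.returnTime (U n) = ((n + k n + 1 : ℕ) : ℕ∞)) ∧
        ((∀ n : ℕ, 1 ≤ n → U n ⊆ U (k n)) ∨ (∀ n : ℕ, 1 ≤ n → U (n + 1) ⊆ U n)) ∧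
        Tendsto (fun n : ℕ => (n : ℝ) * μ.real (U (k n))) atTop (𝓝 0)) ∨
      -- condition (iii)
      (∃ V : ℕ → Set (SFT A),
        (∀ n : ℕ, 1 ≤ n → U n ⊆ V n ∧
          (MeasurableSet[SFT.coordAlgebra A
              (Set.Icc (-(n : ℤ)) (-(n : ℤ) + (SFT.halfReturn (U n) : ℤ)))] (V n) ∨
            MeasurableSet[SFT.coordAlgebra A
              (Set.Icc ((n : ℤ) - (SFT.halfReturn (U n) : ℤ)) ((n : ℤ) - 1))] (V n))) ∧
        Tendsto (fun n : ℕ => (n : ℝ) * μ.real (V n)) atTop (𝓝 0))) :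
    ConvergesInLawToExpOne μ (fun n => SFT.rescaledEntryTime μ (U n)) := by
  have := hμ.isProbabilityMeasure
  have hσ := hμ.measurePreserving
  have hψ := hμ.isPsiMixing ha hA
  have hdet : ∀ n, SFT.DeterminedBy (U n) (Set.Ico (-(n : ℤ)) n) := fun n =>
    SFT.DeterminedBy.of_measurableSet (hU n)
  have hUm : ∀ n, MeasurableSet (U n) := fun n => (hdet n).measurableSet
  have hpre : ∀ n m, μ.real (SFT.shift^[m] ⁻¹' U n) = μ.real (U n) := fun n m =>
    (hσ.iterate m).measureReal_preimage (hUm n).nullMeasurableSet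
  have hb0 : ∀ n, 0 ≤ μ.real (U n) := fun n => measureReal_nonneg
  obtain ⟨K, hK, hmul⟩ := hψ.le_mul
  obtain ⟨g, hg⟩ := hψ.exists_returnTime_le hσ
  have hret_le : ∀ n, 1 ≤ n → SFT.returnTime (U n) ≤ ((2 * n + g : ℕ) : ℕ∞) := fun n hn =>
    hg n (U n) hn (hdet n) (hpos n)
  have huniv : U 0 = Set.univ := by
    obtain ⟨x, hx⟩ := nonempty_of_measure_ne_zero (hpos 0).ne'
    exact Set.eq_univ_of_forall fun y => hdet 0 (fun i hi => by simp at hi) hx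
  -- only the times `j ≥ η n` contribute to the returns
  have hreduce : ∀ (e : ℕ → ℝ), (∀ n, 1 ≤ n → μ.real (U n) ≤ e n) →
      Tendsto (fun n : ℕ => (n : ℝ) * e n) atTop (𝓝 0) →
      (∀ n, 1 ≤ n → ∀ j : ℕ, 1 ≤ j → SFT.returnTime (U n) ≤ j →
        μ.real (U n ∩ SFT.shift^[j] ⁻¹' U n) ≤ K * (e n * μ.real (U n))) →
      ConvergesInLawToExpOne μ (fun n => SFT.rescaledEntryTime μ (U n)) := by
    intro e hUe he hret
    refine SFT.convergesInLaw_of_rare_returns hμ hψ hdet hpos hK he hUe fun n hn j hj => ?_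
    rcases (U n ∩ SFT.shift^[j] ⁻¹' U n).eq_empty_or_nonempty with h0 | h0
    · rw [h0, measureReal_empty]
      exact mul_nonneg hK (mul_nonneg ((hb0 n).trans (hUe n hn)) (hb0 n))
    · exact hret n hn j hj (SFT.returnTime_le hj h0)
  -- returns to `U n` from a set `V ⊇ U n` whose coordinates end before those of the translate
  have hleft : ∀ (n j : ℕ) (V : Set (SFT A)) (s t : ℤ), U n ⊆ V →
      SFT.DeterminedBy V (Set.Ico s t) → t ≤ -n + j + 1 →
      μ.real (U n ∩ SFT.shift^[j] ⁻¹' U n) ≤ K * (μ.real V * μ.real (U n)) := by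
    intro n j V s t hUV hV hle
    refine (measureReal_mono (Set.inter_subset_inter_left _ hUV)).trans ?_
    rw [← hpre n j]
    refine hmul V _ s t (-n + j) (n + j) hV ((hdet n).preimage j fun i hi => ?_) hle
    obtain ⟨h1, h2⟩ := hi
    constructor <;> omega
  rcases h with ⟨hnest, hlim⟩ | ⟨k, -, hη, hincl, hlim⟩ | ⟨V, hV, hlim⟩
  · have hanti : Antitone fun n => SFT.shift^[n] ⁻¹' U n := by
      refine antitone_nat_of_succ_le fun n => ?_
      rcases Nat.eq_zero_or_pos n with rfl | hn
      · simp [huniv]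
      · exact hnest n hn
    have hb : Antitone fun n => μ.real (U n) := fun m n hmn => by
      simp only
      rw [← hpre m m, ← hpre n n]
      exact measureReal_mono (hanti hmn)
    have hhalf : ∀ n, 1 ≤ n → SFT.halfReturn (U n) ≤ n + g := fun n hn => by
      have := SFT.two_mul_halfReturn_le (hret_le n hn)
      omega
    refine hreduce (fun n => μ.real (U (min (SFT.halfReturn (U n)) n)))
      (fun n _ => hb (min_le_right _ _)) (tendsto_mul_min hb hb0 hhalf hlim)
      fun n hn j hj hηj => ?_
    set m := min (SFT.halfReturn (U n)) n with hm
    have h2m : 2 * m ≤ j :=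
      (Nat.mul_le_mul_left 2 (min_le_left _ _)).trans (SFT.two_mul_halfReturn_le hηj)
    -- compare in the one-sided coordinates, where the sets are nested
    have hint : MeasurableSet (U n ∩ SFT.shift^[j] ⁻¹' U n) :=
      (hUm n).inter (SFT.measurable_shift.iterate j (hUm n))
    rw [← (hσ.iterate n).measureReal_preimage hint.nullMeasurableSet, Set.preimage_inter,
      ← Set.preimage_comp, ← Function.iterate_add, ← hpre m m, ← hpre n (j + n)]
    refine (measureReal_mono (Set.inter_subset_inter_left _ (hanti (min_le_right _ n)))).trans
      (hmul _ _ 0 (2 * m : ℕ) j (2 * n + j) ((hdet m).preimage m fun i hi => ?_)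
        ((hdet n).preimage (j + n) fun i hi => ?_) (by omega))
    · obtain ⟨h1, h2⟩ := hi
      constructor <;> push_cast <;> omega
    · obtain ⟨h1, h2⟩ := hi
      constructor <;> push_cast <;> omega
  · have hj : ∀ n, 1 ≤ n → ∀ j : ℕ, SFT.returnTime (U n) ≤ j → n + k n + 1 ≤ j := by
      intro n hn j hηj
      rw [hη n hn] at hηj
      exact_mod_cast hηj
    rcases hincl with hincl | hincl
    · exact hreduce (fun n => μ.real (U (k n))) (fun n hn => measureReal_mono (hincl n hn)) hlim
        fun n hn j _ hηj => hleft n j _ _ _ (hincl n hn) (hdet (k n))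
          (by have := hj n hn j hηj; omega)
    · have hanti : Antitone U := by
        refine antitone_nat_of_succ_le fun n => ?_
        rcases Nat.eq_zero_or_pos n with rfl | hn
        · simp [huniv]
        · exact hincl n hn
      have hb : Antitone fun n => μ.real (U n) := fun m n hmn => measureReal_mono (hanti hmn)
      have hk : ∀ n, 1 ≤ n → k n ≤ n + g := fun n hn => by
        have := hj n hn _ (hret_le n hn)
        omega
      exact hreduce (fun n => μ.real (U (min (k n) n))) (fun n _ => hb (min_le_right _ _))
        (tendsto_mul_min hb hb0 hk hlim)
        fun n hn j _ hηj => hleft n j _ _ _ (hanti (min_le_right _ n)) (hdet _)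
          (by have := hj n hn j hηj; have := min_le_left (k n) n; omega)
  · refine hreduce (fun n => μ.real (V n)) (fun n hn => measureReal_mono (hV n hn).1) hlim
      fun n hn j _ hηj => ?_
    obtain ⟨hUV, hVm | hVm⟩ := hV n hn
    · have hVdet := (SFT.DeterminedBy.of_measurableSet hVm).mono
        (J := Set.Ico (-(n : ℤ)) (-n + SFT.halfReturn (U n) + 1))
        fun i hi => ⟨hi.1, Int.lt_add_one_of_le hi.2⟩
      have := SFT.two_mul_halfReturn_le hηj
      exact hleft n j _ _ _ hUV hVdet (by omega)
    · have hVdet := (SFT.DeterminedBy.of_measurableSet hVm).mono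
        (J := Set.Ico ((n : ℤ) - SFT.halfReturn (U n)) n)
        fun i hi => ⟨hi.1, Int.lt_of_le_sub_one hi.2⟩
      have h2 := SFT.two_mul_halfReturn_le hηj
      have hVmeas : MeasurableSet (V n) := hVdet.measurableSet
      refine (measureReal_mono (Set.inter_subset_inter_right _ (Set.preimage_mono hUV))).trans ?_
      rw [mul_comm (μ.real (V n)),
        ← (hσ.iterate j).measureReal_preimage hVmeas.nullMeasurableSet]
      refine hmul _ _ _ _ (n - SFT.halfReturn (U n) + j) (n + j) (hdet n)
        (hVdet.preimage j fun i hi => ?_) (by omega)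
      obtain ⟨h3, h4⟩ := hi
      constructor <;> omega
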